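/- **Type theories.** A dependent type theory derives statements $\mathcal J\,[\Gamma]$, where $\Gamma=[x_0\in A_0,\dots,x_{n-1}\in A_{n-1}(x_0,\dots,x_{n-2})]$ is a context and $\mathcal J$ is a judgement of one of the forms $A\in\mathrm{Type}$, $a\in A$, $A=B\in\mathrm{Type}$, $a=b\in A$. Type and term expressions are built from variables by type and term constructors, which may bind variables. The derivable statements are closed under the variable rule $x\in A\,[\Gamma,x\in A]$ (if $A \in \mathrm{Type}\,[\Gamma]$), weakening, substitution, reflexivity, symmetry and transitivity of definitional equality of types and of terms, conversion along definitional equality of types, and congruence (substituting definitionally equal terms in a type or term gives definitionally equal results); a statement is derivable only if its presuppositions are (its context is well formed, $A$ is a type if $a\in A$, and so on). Further constructors and rules are allowed. The theory has *strong unit and sum types* if it has a type $1$ and a term $*\in 1$ with $a=*\in 1$ for all $a\in 1$, and a type $\Sigma x\in A.B$ for all $A\in\mathrm{Type}$ and $B\in\mathrm{Type}\,[x\in A]$, with pairing $\mathbf p ab\in\Sigma x\in A.B$ for $a\in A$, $b\in B[a/x]$ and projections $\mathbf p_0c\in A$, $\mathbf p_1c\in B[\mathbf p_0c/x]$ for $c\in\Sigma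 x\in A.B$, such that $\mathbf p_0(\mathbf pab)=a$, $\mathbf p_1(\mathbf pab)=b$, $\mathbf p(\mathbf p_0c)(\mathbf p_1c)=c$ hold definitionally, together with the congruence rules. It has *propositional identity types* if there are a type $\mathrm{Id}_A(a,b)$ for $a,b\in A$ and a term $\mathbf r(a)\in\mathrm{Id}_A(a,a)$ for $a\in A$ such that, whenever $C(x,y,u)\in\mathrm{Type}\,[x\in A,y\in A,u\in\mathrm{Id}_A(x,y),\Delta(x,y,u)]$ and $d(x)\in C(x,x,\mathbf r(x))\,[x\in A,\Delta(x,x,\mathbf r(x))]$ for a context extension $\Delta$ (possibly empty), there are terms $$\mathbf J(a,b,p,d)\in C(a,b,p)\ [\Delta(a,b,p)]\qquad\text{for all } a,b\in A,\ p\in\mathrm{Id}_A(a,b),$$ $$\mathbf H(a,d)\in\mathrm{Id}_{C(a,a,\mathbf r(a))}\bigl(\mathbf J(a,a,\mathbf r(a),d),\,d(a)\bigr)\ [\Delta(a,a,\mathbf r(a))]\qquad\text{for all } a\in A,$$ together with the congruence rules. All these rules hold in an arbitrary ambient context, and all these constructors commute with substitution. **Classifying category.** Its objects are the well-formed contexts,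 where two contexts of the same length are identified if their types are (successively) derivably equal. A morphism from $\Delta$ to $\Gamma=[x_0\in A_0,\dots,x_{n-1}\in A_{n-1}]$ is a sequence of terms $(t_0,\dots,t_{n-1})$ with $t_i\in A_i(t_0,\dots,t_{i-1})\,[\Delta]$ derivable for all $i$, where two sequences are identified if they are componentwise derivably equal; composition is substitution. *Display maps* are the projections $[\Gamma,x\in A]\to\Gamma$; *dependent projections* are the closure of the display maps under identities and composition; *fibrations* are the morphisms isomorphic (in the arrow category) to a dependent projection. Two morphisms $f,g:X\to Y$ are *homotopic* if there are a closed type $A$, an isomorphism $e:Y\cong[x\in A]$ and a morphism $h:X\to[x\in A,y\in A,u\in\mathrm{Id}_A(x,y)]$ whose $x$- and $y$-components are $ef$ and $eg$. A morphism $f:X\to Y$ is a *homotopy equivalence* if there is $g:Y\to X$ such that $gf$ and $fg$ are homotopic to $1_X$ and $1_Y$. **Path categories.** A *path category* is a category with two classes of morphisms, fibrations and weak equivalences (a morphism in both classes is an acyclic fibration), such that: 1. isomorphisms are fibrations and fibrations are closed under composition; 2. the pullback of a fibration along any map exists and is a fibration; 3. there is a terminal object and every map to it is a fibration; 4. isomorphisms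 are weak equivalences; 5. if $f:A\to B$, $g:B\to C$, $h:C\to D$ are such that $gf$ and $hg$ are weak equivalences, then so are $f$, $g$, $h$ and $hgf$; 6. for every object $B$ the diagonal $B\to B\times B$ factors as a weak equivalence followed by a fibration; 7. every acyclic fibration has a section; 8. the pullback of an acyclic fibration along any map exists and is an acyclic fibration. **Theorem.** The classifying category of any type theory with strong unit and sum types and propositional identity types is a path category, with the fibrations described above and with the homotopy equivalences as the weak equivalences. -/

import Mathlib

open CategoryTheory CategoryTheory.Limits

universe u v

namespace DTT

/-! ### Raw syntax -/

/-- The two kinds of raw expressions: type expressions and term expressions. -/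
inductive Kind : Type
  | ty
  | tm

/-- `extend n k` is the number of variables in scope after adding `k` variables to `n` given ones;
it equals `n + k`, but is computed so that contexts and telescopes can be concatenated
without transporting along equations of natural numbers. -/
def extend : ℕ → ℕ → ℕ
  | n, 0 => n
  | n, k + 1 => extend (n + 1) k

/-- A signature of type and term constructors. The constructor `o` forms an expression of kind
`kind o` out of `arity o` arguments; the `i`-th argument is an expression of kind `argKind o i`,
in which `argBind o i` variables get bound. -/
structure Signature : Type (u + 1) where
  Op : Type u
  kind : Op → Kind
  arity : Op → ℕ
  argKind : (o : Op) → Fin (arity o) → Kind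
  argBind : (o : Op) → Fin (arity o) → ℕ

/-- Raw expressions of a given kind, with free variables among `n` given ones
(de Bruijn indices: the variable `0` is the last one of the context). -/
inductive Expr (S : Signature.{u}) : Kind → ℕ → Type u
  | var {n : ℕ} (i : Fin n) : Expr S Kind.tm n
  | op {n : ℕ} (o : S.Op)
      (args : ∀ i : Fin (S.arity o), Expr S (S.argKind o i) (extend n (S.argBind o i))) :
      Expr S (S.kind o) n

/-- Raw types in `n` variables. -/
abbrev Ty (S : Signature.{u}) (n : ℕ) : Type u := Expr S Kind.ty n

/-- Raw terms in `n` variables. -/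
abbrev Tm (S : Signature.{u}) (n : ℕ) : Type u := Expr S Kind.tm n

/-- Substitutions: a term in `m` variables for each of `n` variables. -/
abbrev Sub (S : Signature.{u}) (n m : ℕ) : Type u := Fin n → Tm S m

section Substitution

variable {S : Signature.{u}}

/-- Extend a renaming to one more variable. -/
def liftRen {n m : ℕ} (ρ : Fin n → Fin m) : Fin (n + 1) → Fin (m + 1) :=
  Fin.cases 0 (fun i => (ρ i).succ)

/-- Extend a renaming to `k` more variables. -/
def liftRenN : ∀ (k : ℕ) {n m : ℕ}, (Fin n → Fin m) → Fin (extend n k) → Fin (extend m k)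
  | 0, _, _, ρ => ρ
  | k + 1, _, _, ρ => liftRenN k (liftRen ρ)

/-- Renaming of variables. -/
def Expr.rename {κ : Kind} {n : ℕ} (e : Expr S κ n) : ∀ {m : ℕ}, (Fin n → Fin m) → Expr S κ m :=
  match e with
  | .var i => fun ρ => .var (ρ i)
  | .op o args => fun ρ => .op o (fun i => (args i).rename (liftRenN _ ρ))

/-- Extend a substitution to one more variable, which is mapped to itself. -/
def Sub.lift {n m : ℕ} (σ : Sub S n m) : Sub S (n + 1) (m + 1) :=
  Fin.cases (.var 0) (fun i => (σ i).rename Fin.succ)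

/-- Extend a substitution to `k` more variables, which are mapped to themselves. -/
def Sub.liftN : ∀ (k : ℕ) {n m : ℕ}, Sub S n m → Sub S (extend n k) (extend m k)
  | 0, _, _, σ => σ
  | k + 1, _, _, σ => Sub.liftN k (Sub.lift σ)

/-- Capture-avoiding simultaneous substitution. -/
def Expr.subst {κ : Kind} {n : ℕ} (e : Expr S κ n) : ∀ {m : ℕ}, Sub S n m → Expr S κ m :=
  match e with
  | .var i => fun σ => σ i
  | .op o args => fun σ => .op o (fun i => (args i).subst (Sub.liftN _ σ))

/-- The identity substitution. -/
def Sub.id (S : Signature.{u}) (n : ℕ) : Sub S n n := fun i => .var i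

/-- The weakening substitution: adds a dummy last variable. -/
def Sub.wk (S : Signature.{u}) (n : ℕ) : Sub S n (n + 1) := fun i => .var i.succ

/-- The substitution which maps the last variable to `a` and the others as `σ` does. -/
def Sub.cons {n m : ℕ} (σ : Sub S n m) (a : Tm S m) : Sub S (n + 1) m := Fin.cases a σ

/-- The restriction of a substitution to all but the last variable. -/
def Sub.tail {n m : ℕ} (σ : Sub S (n + 1) m) : Sub S n m := fun i => σ i.succ

/-- The substitution `[a/x]` of `a` for the last variable `x`. -/
def Sub.inst {n : ℕ} (a : Tm S n) : Sub S (n + 1) n := (Sub.id S n).cons a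

/-- First `σ`, then `τ`. -/
def Sub.comp {n m k : ℕ} (σ : Sub S n m) (τ : Sub S m k) : Sub S n k := fun i => (σ i).subst τ

end Substitution

/-- Raw contexts `[x₀ ∈ A₀, …, xₙ₋₁ ∈ Aₙ₋₁]` of length `n`. -/
inductive Ctx (S : Signature.{u}) : ℕ → Type u
  | nil : Ctx S 0
  | snoc {n : ℕ} (Γ : Ctx S n) (A : Ty S n) : Ctx S (n + 1)

/-- Raw context extensions (telescopes) of length `k` over a context of length `n`. -/
inductive Tel (S : Signature.{u}) : ℕ → ℕ → Type u
  | nil {n : ℕ} : Tel S n 0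
  | cons {n k : ℕ} (A : Ty S n) (Ξ : Tel S (n + 1) k) : Tel S n (k + 1)

/-- The concatenation `[Γ, Ξ]`. -/
def Ctx.append {S : Signature.{u}} :
    ∀ {k n : ℕ}, Ctx S n → Tel S n k → Ctx S (extend n k)
  | _, _, Γ, .nil => Γ
  | _, n, Γ, .cons A Ξ => Ctx.append (n := n + 1) (Γ.snoc A) Ξ

/-- Substitution in a telescope. -/
def Tel.subst {S : Signature.{u}} : ∀ {k n m : ℕ}, Tel S n k → Sub S n m → Tel S m k
  | _, _, _, .nil, _ => .nil
  | _, _, _, .cons A Ξ, σ => .cons (A.subst σ) (Ξ.subst σ.lift)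

/-- The four forms of judgement: `A ∈ Type`, `a ∈ A`, `A = B ∈ Type`, `a = b ∈ A`. -/
inductive Judgement (S : Signature.{u}) (n : ℕ) : Type u
  | isType (A : Ty S n)
  | hasType (a : Tm S n) (A : Ty S n)
  | eqType (A B : Ty S n)
  | eqTerm (a b : Tm S n) (A : Ty S n)

/-- Substitution in a judgement. -/
def Judgement.subst {S : Signature.{u}} {n m : ℕ} (J : Judgement S n) (σ : Sub S n m) :
    Judgement S m :=
  match J with
  | .isType A => .isType (A.subst σ)
  | .hasType a A => .hasType (a.subst σ) (A.subst σ)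
  | .eqType A B => .eqType (A.subst σ) (B.subst σ)
  | .eqTerm a b A => .eqTerm (a.subst σ) (b.subst σ) (A.subst σ)

/-! ### Type theories -/

/-- A dependent type theory over the signature `S`: a collection of derivable statements
`J [Γ]` closed under the basic rules of dependent type theory. Further rules may hold as well.
The rules `subst_congr_type` and `subst_congr_term` express the convention that every type and
term constructor comes with its congruence rules. The last group of fields says that a statement
is derivable only if its presuppositions are. -/
structure TypeTheory (S : Signature.{u}) : Type u where
  Derivable : ∀ {n : ℕ}, Ctx S n → Judgement S n → Prop
  /-- the rule for variables: `x ∈ A [Γ, x ∈ A]` -/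
  var_rule : ∀ {n : ℕ} {Γ : Ctx S n} {A : Ty S n}, Derivable Γ (.isType A) →
    Derivable (Γ.snoc A) (.hasType (.var 0) (A.subst (Sub.wk S n)))
  /-- from `J [Γ, Ξ]` and `A ∈ Type [Γ]` infer `J [Γ, x ∈ A, Ξ]` -/
  weakening : ∀ {n k : ℕ} {Γ : Ctx S n} {A : Ty S n} {Ξ : Tel S n k}
    {J : Judgement S (extend n k)},
    Derivable (Γ.append Ξ) J → Derivable Γ (.isType A) →
    Derivable ((Γ.snoc A).append (Ξ.subst (Sub.wk S n))) (J.subst ((Sub.wk S n).liftN k))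
  /-- from `J [Γ, x ∈ A, Ξ]` and `a ∈ A [Γ]` infer `J[a/x] [Γ, Ξ[a/x]]` -/
  substitution : ∀ {n k : ℕ} {Γ : Ctx S n} {A : Ty S n} {Ξ : Tel S (n + 1) k}
    {J : Judgement S (extend (n + 1) k)} {a : Tm S n},
    Derivable ((Γ.snoc A).append Ξ) J → Derivable Γ (.hasType a A) →
    Derivable (Γ.append (Ξ.subst (Sub.inst a))) (J.subst ((Sub.inst a).liftN k))
  type_refl : ∀ {n : ℕ} {Γ : Ctx S n} {A : Ty S n},
    Derivable Γ (.isType A) → Derivable Γ (.eqType A A)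
  type_symm : ∀ {n : ℕ} {Γ : Ctx S n} {A B : Ty S n},
    Derivable Γ (.eqType A B) → Derivable Γ (.eqType B A)
  type_trans : ∀ {n : ℕ} {Γ : Ctx S n} {A B C : Ty S n},
    Derivable Γ (.eqType A B) → Derivable Γ (.eqType B C) → Derivable Γ (.eqType A C)
  term_refl : ∀ {n : ℕ} {Γ : Ctx S n} {A : Ty S n} {a : Tm S n},
    Derivable Γ (.hasType a A) → Derivable Γ (.eqTerm a a A)
  term_symm : ∀ {n : ℕ} {Γ : Ctx S n} {A : Ty S n} {a b : Tm S n},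
    Derivable Γ (.eqTerm a b A) → Derivable Γ (.eqTerm b a A)
  term_trans : ∀ {n : ℕ} {Γ : Ctx S n} {A : Ty S n} {a b c : Tm S n},
    Derivable Γ (.eqTerm a b A) → Derivable Γ (.eqTerm b c A) → Derivable Γ (.eqTerm a c A)
  conv_hasType : ∀ {n : ℕ} {Γ : Ctx S n} {A B : Ty S n} {a : Tm S n},
    Derivable Γ (.hasType a A) → Derivable Γ (.eqType A B) → Derivable Γ (.hasType a B)
  conv_eqTerm : ∀ {n : ℕ} {Γ : Ctx S n} {A B : Ty S n} {a b : Tm S n},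
    Derivable Γ (.eqTerm a b A) → Derivable Γ (.eqType A B) → Derivable Γ (.eqTerm a b B)
  /-- from `B ∈ Type [Γ, x ∈ A, Ξ]` and `a = a' ∈ A [Γ]` infer
  `B[a/x] = B[a'/x] ∈ Type [Γ, Ξ[a/x]]` -/
  subst_congr_type : ∀ {n k : ℕ} {Γ : Ctx S n} {A : Ty S n} {Ξ : Tel S (n + 1) k}
    {B : Ty S (extend (n + 1) k)} {a a' : Tm S n},
    Derivable ((Γ.snoc A).append Ξ) (.isType B) → Derivable Γ (.eqTerm a a' A) →
    Derivable (Γ.append (Ξ.subst (Sub.inst a)))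
      (.eqType (B.subst ((Sub.inst a).liftN k)) (B.subst ((Sub.inst a').liftN k)))
  /-- from `b ∈ B [Γ, x ∈ A, Ξ]` and `a = a' ∈ A [Γ]` infer
  `b[a/x] = b[a'/x] ∈ B[a/x] [Γ, Ξ[a/x]]` -/
  subst_congr_term : ∀ {n k : ℕ} {Γ : Ctx S n} {A : Ty S n} {Ξ : Tel S (n + 1) k}
    {B : Ty S (extend (n + 1) k)} {b : Tm S (extend (n + 1) k)} {a a' : Tm S n},
    Derivable ((Γ.snoc A).append Ξ) (.hasType b B) → Derivable Γ (.eqTerm a a' A) →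
    Derivable (Γ.append (Ξ.subst (Sub.inst a)))
      (.eqTerm (b.subst ((Sub.inst a).liftN k)) (b.subst ((Sub.inst a').liftN k))
        (B.subst ((Sub.inst a).liftN k)))
  /-- statements are derivable only in well-formed contexts -/
  presup_ctx : ∀ {n : ℕ} {Γ : Ctx S n} {A : Ty S n} {J : Judgement S (n + 1)},
    Derivable (Γ.snoc A) J → Derivable Γ (.isType A)
  presup_hasType : ∀ {n : ℕ} {Γ : Ctx S n} {A : Ty S n} {a : Tm S n},
    Derivable Γ (.hasType a A) → Derivable Γ (.isType A)
  presup_eqType : ∀ {n : ℕ} {Γ : Ctx S n} {A B : Ty S n},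
    Derivable Γ (.eqType A B) → Derivable Γ (.isType A)
  presup_eqTerm : ∀ {n : ℕ} {Γ : Ctx S n} {A : Ty S n} {a b : Tm S n},
    Derivable Γ (.eqTerm a b A) → Derivable Γ (.hasType a A)

/-- Well-formed contexts: each type is derivably a type in the context preceding it. -/
def TypeTheory.WF {S : Signature.{u}} (T : TypeTheory S) : ∀ {n : ℕ}, Ctx S n → Prop
  | _, .nil => True
  | _, .snoc Γ A => T.WF Γ ∧ T.Derivable Γ (.isType A)

/-- Strong unit and sum types. A type or term former is an operation on raw expressions which
commutes with substitution. The operations for pairing and the projections are allowed to depend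
on the types involved. -/
structure StrongSums {S : Signature.{u}} (T : TypeTheory S) : Type u where
  unit : ∀ {n : ℕ}, Ty S n
  star : ∀ {n : ℕ}, Tm S n
  sigma : ∀ {n : ℕ}, Ty S n → Ty S (n + 1) → Ty S n
  pair : ∀ {n : ℕ}, Ty S n → Ty S (n + 1) → Tm S n → Tm S n → Tm S n
  fst : ∀ {n : ℕ}, Ty S n → Ty S (n + 1) → Tm S n → Tm S n
  snd : ∀ {n : ℕ}, Ty S n → Ty S (n + 1) → Tm S n → Tm S n
  unit_subst : ∀ {n m : ℕ} (σ : Sub S n m), (unit (n := n)).subst σ = unit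
  star_subst : ∀ {n m : ℕ} (σ : Sub S n m), (star (n := n)).subst σ = star
  sigma_subst : ∀ {n m : ℕ} (σ : Sub S n m) (A : Ty S n) (B : Ty S (n + 1)),
    (sigma A B).subst σ = sigma (A.subst σ) (B.subst σ.lift)
  pair_subst : ∀ {n m : ℕ} (σ : Sub S n m) (A : Ty S n) (B : Ty S (n + 1)) (a b : Tm S n),
    (pair A B a b).subst σ = pair (A.subst σ) (B.subst σ.lift) (a.subst σ) (b.subst σ)
  fst_subst : ∀ {n m : ℕ} (σ : Sub S n m) (A : Ty S n) (B : Ty S (n + 1)) (c : Tm S n),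
    (fst A B c).subst σ = fst (A.subst σ) (B.subst σ.lift) (c.subst σ)
  snd_subst : ∀ {n m : ℕ} (σ : Sub S n m) (A : Ty S n) (B : Ty S (n + 1)) (c : Tm S n),
    (snd A B c).subst σ = snd (A.subst σ) (B.subst σ.lift) (c.subst σ)
  unit_form : ∀ {n : ℕ} {Γ : Ctx S n}, T.WF Γ → T.Derivable Γ (.isType unit)
  star_intro : ∀ {n : ℕ} {Γ : Ctx S n}, T.WF Γ → T.Derivable Γ (.hasType star unit)
  unit_eta : ∀ {n : ℕ} {Γ : Ctx S n} {a : Tm S n},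
    T.Derivable Γ (.hasType a unit) → T.Derivable Γ (.eqTerm a star unit)
  sigma_form : ∀ {n : ℕ} {Γ : Ctx S n} {A : Ty S n} {B : Ty S (n + 1)},
    T.Derivable Γ (.isType A) → T.Derivable (Γ.snoc A) (.isType B) →
    T.Derivable Γ (.isType (sigma A B))
  pair_intro : ∀ {n : ℕ} {Γ : Ctx S n} {A : Ty S n} {B : Ty S (n + 1)} {a b : Tm S n},
    T.Derivable (Γ.snoc A) (.isType B) →
    T.Derivable Γ (.hasType a A) → T.Derivable Γ (.hasType b (B.subst (Sub.inst a))) →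
    T.Derivable Γ (.hasType (pair A B a b) (sigma A B))
  fst_elim : ∀ {n : ℕ} {Γ : Ctx S n} {A : Ty S n} {B : Ty S (n + 1)} {c : Tm S n},
    T.Derivable (Γ.snoc A) (.isType B) →
    T.Derivable Γ (.hasType c (sigma A B)) → T.Derivable Γ (.hasType (fst A B c) A)
  snd_elim : ∀ {n : ℕ} {Γ : Ctx S n} {A : Ty S n} {B : Ty S (n + 1)} {c : Tm S n},
    T.Derivable (Γ.snoc A) (.isType B) →
    T.Derivable Γ (.hasType c (sigma A B)) →
    T.Derivable Γ (.hasType (snd A B c) (B.subst (Sub.inst (fst A B c))))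
  fst_pair : ∀ {n : ℕ} {Γ : Ctx S n} {A : Ty S n} {B : Ty S (n + 1)} {a b : Tm S n},
    T.Derivable (Γ.snoc A) (.isType B) →
    T.Derivable Γ (.hasType a A) → T.Derivable Γ (.hasType b (B.subst (Sub.inst a))) →
    T.Derivable Γ (.eqTerm (fst A B (pair A B a b)) a A)
  snd_pair : ∀ {n : ℕ} {Γ : Ctx S n} {A : Ty S n} {B : Ty S (n + 1)} {a b : Tm S n},
    T.Derivable (Γ.snoc A) (.isType B) →
    T.Derivable Γ (.hasType a A) → T.Derivable Γ (.hasType b (B.subst (Sub.inst a))) →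
    T.Derivable Γ (.eqTerm (snd A B (pair A B a b)) b (B.subst (Sub.inst a)))
  pair_eta : ∀ {n : ℕ} {Γ : Ctx S n} {A : Ty S n} {B : Ty S (n + 1)} {c : Tm S n},
    T.Derivable (Γ.snoc A) (.isType B) →
    T.Derivable Γ (.hasType c (sigma A B)) →
    T.Derivable Γ (.eqTerm (pair A B (fst A B c) (snd A B c)) c (sigma A B))
  sigma_congr : ∀ {n : ℕ} {Γ : Ctx S n} {A A' : Ty S n} {B B' : Ty S (n + 1)},
    T.Derivable Γ (.eqType A A') → T.Derivable (Γ.snoc A) (.eqType B B') →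
    T.Derivable Γ (.eqType (sigma A B) (sigma A' B'))
  pair_congr : ∀ {n : ℕ} {Γ : Ctx S n} {A : Ty S n} {B : Ty S (n + 1)} {a a' b b' : Tm S n},
    T.Derivable (Γ.snoc A) (.isType B) →
    T.Derivable Γ (.eqTerm a a' A) → T.Derivable Γ (.eqTerm b b' (B.subst (Sub.inst a))) →
    T.Derivable Γ (.eqTerm (pair A B a b) (pair A B a' b') (sigma A B))
  fst_congr : ∀ {n : ℕ} {Γ : Ctx S n} {A : Ty S n} {B : Ty S (n + 1)} {c c' : Tm S n},
    T.Derivable (Γ.snoc A) (.isType B) →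
    T.Derivable Γ (.eqTerm c c' (sigma A B)) →
    T.Derivable Γ (.eqTerm (fst A B c) (fst A B c') A)
  snd_congr : ∀ {n : ℕ} {Γ : Ctx S n} {A : Ty S n} {B : Ty S (n + 1)} {c c' : Tm S n},
    T.Derivable (Γ.snoc A) (.isType B) →
    T.Derivable Γ (.eqTerm c c' (sigma A B)) →
    T.Derivable Γ (.eqTerm (snd A B c) (snd A B c') (B.subst (Sub.inst (fst A B c))))

section IdSyntax

variable {S : Signature.{u}} (Id : ∀ {n : ℕ}, Ty S n → Tm S n → Tm S n → Ty S n)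
  (r : ∀ {n : ℕ}, Ty S n → Tm S n → Tm S n)

/-- The context extension `[x ∈ A, y ∈ A, u ∈ Id_A(x, y)]` of `Γ`. -/
def idCtx {n : ℕ} (Γ : Ctx S n) (A : Ty S n) : Ctx S (n + 3) :=
  ((Γ.snoc A).snoc (A.subst (Sub.wk S n))).snoc
    (Id ((A.subst (Sub.wk S n)).subst (Sub.wk S (n + 1))) (.var 1) (.var 0))

/-- The substitution `(a, b, p)` for the variables `x, y, u`. -/
def idInst {n : ℕ} (a b p : Tm S n) : Sub S (n + 3) n :=
  (((Sub.id S n).cons a).cons b).cons p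

/-- The substitution `(x, x, r(x))` for the variables `x, y, u`, where `x ∈ A`. -/
def idDiag {n : ℕ} (A : Ty S n) : Sub S (n + 3) (n + 1) :=
  (((Sub.wk S n).cons (.var 0)).cons (.var 0)).cons (r (A.subst (Sub.wk S n)) (.var 0))

end IdSyntax

/-- Propositional identity types: the computation rule holds only up to a term `H` of an
identity type, and the elimination and computation rules have a parameter context `Ξ`.
The operations are allowed to depend on the types involved. The substitution `σ.liftN k` leaves
the `k` variables of `Ξ` unchanged. -/
structure PropositionalIdTypes {S : Signature.{u}} (T : TypeTheory S) : Type u where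
  Id : ∀ {n : ℕ}, Ty S n → Tm S n → Tm S n → Ty S n
  r : ∀ {n : ℕ}, Ty S n → Tm S n → Tm S n
  /-- `J A Ξ C a b p d` is the term `J(a, b, p, d)` -/
  J : ∀ {n k : ℕ}, Ty S n → Tel S (n + 3) k → Ty S (extend (n + 3) k) →
    Tm S n → Tm S n → Tm S n → Tm S (extend (n + 1) k) → Tm S (extend n k)
  /-- `H A Ξ C a d` is the term `H(a, d)` -/
  H : ∀ {n k : ℕ}, Ty S n → Tel S (n + 3) k → Ty S (extend (n + 3) k) →
    Tm S n → Tm S (extend (n + 1) k) → Tm S (extend n k)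
  Id_subst : ∀ {n m : ℕ} (σ : Sub S n m) (A : Ty S n) (a b : Tm S n),
    (Id A a b).subst σ = Id (A.subst σ) (a.subst σ) (b.subst σ)
  r_subst : ∀ {n m : ℕ} (σ : Sub S n m) (A : Ty S n) (a : Tm S n),
    (r A a).subst σ = r (A.subst σ) (a.subst σ)
  J_subst : ∀ {n m k : ℕ} (σ : Sub S n m) (A : Ty S n) (Ξ : Tel S (n + 3) k)
    (C : Ty S (extend (n + 3) k)) (a b p : Tm S n) (d : Tm S (extend (n + 1) k)),
    (J A Ξ C a b p d).subst (σ.liftN k) =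
      J (A.subst σ) (Ξ.subst σ.lift.lift.lift) (C.subst (Sub.liftN k (n := n + 3) σ.lift.lift.lift))
        (a.subst σ) (b.subst σ) (p.subst σ) (d.subst (Sub.liftN k σ.lift))
  H_subst : ∀ {n m k : ℕ} (σ : Sub S n m) (A : Ty S n) (Ξ : Tel S (n + 3) k)
    (C : Ty S (extend (n + 3) k)) (a : Tm S n) (d : Tm S (extend (n + 1) k)),
    (H A Ξ C a d).subst (σ.liftN k) =
      H (A.subst σ) (Ξ.subst σ.lift.lift.lift) (C.subst (Sub.liftN k (n := n + 3) σ.lift.lift.lift))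
        (a.subst σ) (d.subst (Sub.liftN k σ.lift))
  Id_form : ∀ {n : ℕ} {Γ : Ctx S n} {A : Ty S n} {a b : Tm S n},
    T.Derivable Γ (.hasType a A) → T.Derivable Γ (.hasType b A) →
    T.Derivable Γ (.isType (Id A a b))
  r_intro : ∀ {n : ℕ} {Γ : Ctx S n} {A : Ty S n} {a : Tm S n},
    T.Derivable Γ (.hasType a A) → T.Derivable Γ (.hasType (r A a) (Id A a a))
  J_elim : ∀ {n k : ℕ} {Γ : Ctx S n} {A : Ty S n} {Ξ : Tel S (n + 3) k}
    {C : Ty S (extend (n + 3) k)} {a b p : Tm S n} {d : Tm S (extend (n + 1) k)},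
    T.Derivable ((idCtx Id Γ A).append Ξ) (.isType C) →
    T.Derivable Γ (.hasType a A) → T.Derivable Γ (.hasType b A) →
    T.Derivable Γ (.hasType p (Id A a b)) →
    T.Derivable ((Γ.snoc A).append (Ξ.subst (idDiag r A)))
      (.hasType d (C.subst ((idDiag r A).liftN k))) →
    T.Derivable (Γ.append (Ξ.subst (idInst a b p)))
      (.hasType (J A Ξ C a b p d) (C.subst ((idInst a b p).liftN k)))
  H_comp : ∀ {n k : ℕ} {Γ : Ctx S n} {A : Ty S n} {Ξ : Tel S (n + 3) k}
    {C : Ty S (extend (n + 3) k)} {a : Tm S n} {d : Tm S (extend (n + 1) k)},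
    T.Derivable ((idCtx Id Γ A).append Ξ) (.isType C) →
    T.Derivable Γ (.hasType a A) →
    T.Derivable ((Γ.snoc A).append (Ξ.subst (idDiag r A)))
      (.hasType d (C.subst ((idDiag r A).liftN k))) →
    T.Derivable (Γ.append (Ξ.subst (idInst a a (r A a))))
      (.hasType (H A Ξ C a d)
        (Id (C.subst ((idInst a a (r A a)).liftN k))
          (J A Ξ C a a (r A a) d) (d.subst ((Sub.inst a).liftN k))))
  Id_congr : ∀ {n : ℕ} {Γ : Ctx S n} {A A' : Ty S n} {a a' b b' : Tm S n},
    T.Derivable Γ (.eqType A A') → T.Derivable Γ (.eqTerm a a' A) →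
    T.Derivable Γ (.eqTerm b b' A) → T.Derivable Γ (.eqType (Id A a b) (Id A' a' b'))
  r_congr : ∀ {n : ℕ} {Γ : Ctx S n} {A : Ty S n} {a a' : Tm S n},
    T.Derivable Γ (.eqTerm a a' A) → T.Derivable Γ (.eqTerm (r A a) (r A a') (Id A a a))
  J_congr : ∀ {n k : ℕ} {Γ : Ctx S n} {A : Ty S n} {Ξ : Tel S (n + 3) k}
    {C : Ty S (extend (n + 3) k)} {a a' b b' p p' : Tm S n} {d d' : Tm S (extend (n + 1) k)},
    T.Derivable ((idCtx Id Γ A).append Ξ) (.isType C) →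
    T.Derivable Γ (.eqTerm a a' A) → T.Derivable Γ (.eqTerm b b' A) →
    T.Derivable Γ (.eqTerm p p' (Id A a b)) →
    T.Derivable ((Γ.snoc A).append (Ξ.subst (idDiag r A)))
      (.eqTerm d d' (C.subst ((idDiag r A).liftN k))) →
    T.Derivable (Γ.append (Ξ.subst (idInst a b p)))
      (.eqTerm (J A Ξ C a b p d) (J A Ξ C a' b' p' d') (C.subst ((idInst a b p).liftN k)))
  H_congr : ∀ {n k : ℕ} {Γ : Ctx S n} {A : Ty S n} {Ξ : Tel S (n + 3) k}
    {C : Ty S (extend (n + 3) k)} {a a' : Tm S n} {d d' : Tm S (extend (n + 1) k)},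
    T.Derivable ((idCtx Id Γ A).append Ξ) (.isType C) →
    T.Derivable Γ (.eqTerm a a' A) →
    T.Derivable ((Γ.snoc A).append (Ξ.subst (idDiag r A)))
      (.eqTerm d d' (C.subst ((idDiag r A).liftN k))) →
    T.Derivable (Γ.append (Ξ.subst (idInst a a (r A a))))
      (.eqTerm (H A Ξ C a d) (H A Ξ C a' d')
        (Id (C.subst ((idInst a a (r A a)).liftN k))
          (J A Ξ C a a (r A a) d) (d.subst ((Sub.inst a).liftN k))))

/-! ### Substitution lemmas -/

section SubstitutionLemmas

variable {S : Signature.{u}}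

theorem liftRenN_comp : ∀ (k : ℕ) {n m l : ℕ} (ρ : Fin n → Fin m) (θ : Fin m → Fin l),
    (liftRenN k θ) ∘ (liftRenN k ρ) = liftRenN k (θ ∘ ρ)
  | 0, _, _, _, _, _ => rfl
  | k + 1, _, _, _, ρ, θ => by
    have h : liftRen θ ∘ liftRen ρ = liftRen (θ ∘ ρ) := by
      funext i; refine Fin.cases rfl (fun _ => rfl) i
    have := liftRenN_comp k (liftRen ρ) (liftRen θ)
    rw [h] at this
    exact this

theorem Expr.rename_rename {κ : Kind} {n : ℕ} (e : Expr S κ n) :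
    ∀ {m l : ℕ} (ρ : Fin n → Fin m) (θ : Fin m → Fin l),
      (e.rename ρ).rename θ = e.rename (θ ∘ ρ) := by
  induction e with
  | var i => intros; rfl
  | op o args ih =>
    intro m l ρ θ
    simp only [Expr.rename, ih, liftRenN_comp]

theorem Sub.liftN_comp_ren : ∀ (k : ℕ) {n m l : ℕ} (ρ : Fin n → Fin m) (σ : Sub S m l),
    (fun i => Sub.liftN k σ (liftRenN k ρ i)) = Sub.liftN k (fun i => σ (ρ i))
  | 0, _, _, _, _, _ => rfl
  | k + 1, _, _, _, ρ, σ => by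
    have h : (fun i => σ.lift (liftRen ρ i)) = Sub.lift (fun i => σ (ρ i)) := by
      funext i; refine Fin.cases rfl (fun _ => rfl) i
    have := Sub.liftN_comp_ren k (liftRen ρ) σ.lift
    rw [h] at this
    exact this

theorem Expr.subst_rename {κ : Kind} {n : ℕ} (e : Expr S κ n) :
    ∀ {m l : ℕ} (ρ : Fin n → Fin m) (σ : Sub S m l),
      (e.rename ρ).subst σ = e.subst (fun i => σ (ρ i)) := by
  induction e with
  | var i => intros; rfl
  | op o args ih =>
    intro m l ρ σ
    simp only [Expr.rename, Expr.subst, ih, Sub.liftN_comp_ren]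

theorem Sub.ren_comp_liftN : ∀ (k : ℕ) {n m l : ℕ} (σ : Sub S n m) (ρ : Fin m → Fin l),
    (fun i => (Sub.liftN k σ i).rename (liftRenN k ρ)) = Sub.liftN k (fun i => (σ i).rename ρ)
  | 0, _, _, _, _, _ => rfl
  | k + 1, _, _, _, σ, ρ => by
    have h : (fun i => (σ.lift i).rename (liftRen ρ)) = Sub.lift (fun i => (σ i).rename ρ) := by
      funext i
      refine Fin.cases rfl (fun j => ?_) i
      change ((σ j).rename Fin.succ).rename (liftRen ρ) = ((σ j).rename ρ).rename Fin.succ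
      rw [Expr.rename_rename, Expr.rename_rename]
      rfl
    have := Sub.ren_comp_liftN k σ.lift (liftRen ρ)
    rw [h] at this
    exact this

theorem Expr.rename_subst {κ : Kind} {n : ℕ} (e : Expr S κ n) :
    ∀ {m l : ℕ} (σ : Sub S n m) (ρ : Fin m → Fin l),
      (e.subst σ).rename ρ = e.subst (fun i => (σ i).rename ρ) := by
  induction e with
  | var i => intros; rfl
  | op o args ih =>
    intro m l σ ρ
    simp only [Expr.rename, Expr.subst, ih, Sub.ren_comp_liftN]

theorem Sub.lift_comp {n m l : ℕ} (σ : Sub S n m) (τ : Sub S m l) :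
    σ.lift.comp τ.lift = (σ.comp τ).lift := by
  funext i
  refine Fin.cases rfl (fun j => ?_) i
  change ((σ j).rename Fin.succ).subst τ.lift = ((σ j).subst τ).rename Fin.succ
  rw [Expr.subst_rename, Expr.rename_subst]
  rfl

theorem Sub.liftN_comp : ∀ (k : ℕ) {n m l : ℕ} (σ : Sub S n m) (τ : Sub S m l),
    (Sub.liftN k σ).comp (Sub.liftN k τ) = Sub.liftN k (σ.comp τ)
  | 0, _, _, _, _, _ => rfl
  | k + 1, _, _, _, σ, τ => by
    have := Sub.liftN_comp k σ.lift τ.lift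
    rw [Sub.lift_comp] at this
    exact this

theorem Expr.subst_subst {κ : Kind} {n : ℕ} (e : Expr S κ n) :
    ∀ {m l : ℕ} (σ : Sub S n m) (τ : Sub S m l),
      (e.subst σ).subst τ = e.subst (σ.comp τ) := by
  induction e with
  | var i => intros; rfl
  | op o args ih =>
    intro m l σ τ
    simp only [Expr.subst, ih, Sub.liftN_comp]

theorem Sub.lift_id (n : ℕ) : (Sub.id S n).lift = Sub.id S (n + 1) := by
  funext i; refine Fin.cases rfl (fun _ => rfl) i

theorem Sub.liftN_id : ∀ (k n : ℕ), Sub.liftN k (Sub.id S n) = Sub.id S (extend n k)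
  | 0, _ => rfl
  | k + 1, n => by
    have := Sub.liftN_id k (n + 1)
    rw [← Sub.lift_id] at this
    exact this

theorem Expr.subst_id {κ : Kind} {n : ℕ} (e : Expr S κ n) : e.subst (Sub.id S n) = e := by
  induction e with
  | var i => rfl
  | op o args ih => simp only [Expr.subst, Sub.liftN_id, ih]

theorem Sub.liftN_ren : ∀ (k : ℕ) {n m : ℕ} (ρ : Fin n → Fin m),
    Sub.liftN k (fun i => (.var (ρ i) : Tm S m)) = fun i => .var (liftRenN k ρ i)
  | 0, _, _, _ => rfl
  | k + 1, _, _, ρ => by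
    have h : Sub.lift (fun i => (.var (ρ i) : Tm S _)) = fun i => .var (liftRen ρ i) := by
      funext i; refine Fin.cases rfl (fun _ => rfl) i
    have := Sub.liftN_ren k (liftRen ρ)
    rw [← h] at this
    exact this

theorem Expr.rename_eq_subst {κ : Kind} {n : ℕ} (e : Expr S κ n) :
    ∀ {m : ℕ} (ρ : Fin n → Fin m), e.rename ρ = e.subst (fun i => .var (ρ i)) := by
  induction e with
  | var i => intros; rfl
  | op o args ih =>
    intro m ρ
    simp only [Expr.rename, Expr.subst, ih, Sub.liftN_ren]

theorem Sub.id_comp {n m : ℕ} (σ : Sub S n m) : (Sub.id S n).comp σ = σ := rfl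

theorem Sub.comp_id {n m : ℕ} (σ : Sub S n m) : σ.comp (Sub.id S m) = σ :=
  funext fun i => (σ i).subst_id

theorem Sub.comp_assoc {n m l q : ℕ} (σ : Sub S n m) (τ : Sub S m l) (υ : Sub S l q) :
    (σ.comp τ).comp υ = σ.comp (τ.comp υ) :=
  funext fun i => (σ i).subst_subst τ υ

theorem Sub.lift_succ {n m : ℕ} (σ : Sub S n m) (i : Fin n) :
    σ.lift i.succ = (σ i).subst (Sub.wk S m) :=
  (σ i).rename_eq_subst Fin.succ

theorem Sub.tail_lift {n m : ℕ} (σ : Sub S n m) : σ.lift.tail = σ.comp (Sub.wk S m) :=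
  funext fun i => σ.lift_succ i

theorem Sub.lift_comp_cons {n m l : ℕ} (σ : Sub S n m) (τ : Sub S m l) (a : Tm S l) :
    σ.lift.comp (τ.cons a) = (σ.comp τ).cons a := by
  funext i
  refine Fin.cases rfl (fun j => ?_) i
  change ((σ j).rename Fin.succ).subst (τ.cons a) = (σ j).subst τ
  rw [Expr.subst_rename]
  rfl

theorem Sub.lift_comp_inst {n m : ℕ} (σ : Sub S n m) (a : Tm S m) :
    σ.lift.comp (Sub.inst a) = σ.cons a := by
  unfold Sub.inst
  rw [Sub.lift_comp_cons, Sub.comp_id]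

theorem Sub.cons_tail {n m : ℕ} (σ : Sub S (n + 1) m) : σ.tail.cons (σ 0) = σ := by
  funext i; refine Fin.cases rfl (fun _ => rfl) i

theorem Tel.subst_subst {k n : ℕ} (Ξ : Tel S n k) :
    ∀ {m l : ℕ} (σ : Sub S n m) (τ : Sub S m l),
      (Ξ.subst σ).subst τ = Ξ.subst (σ.comp τ) := by
  induction Ξ with
  | nil => intros; rfl
  | cons A Ξ ih =>
    intro m l σ τ
    simp only [Tel.subst, ih, Expr.subst_subst, Sub.lift_comp]

theorem Tel.subst_id {k n : ℕ} (Ξ : Tel S n k) : Ξ.subst (Sub.id S n) = Ξ := by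
  induction Ξ with
  | nil => rfl
  | cons A Ξ ih => simp only [Tel.subst, Sub.lift_id, ih, Expr.subst_id]

theorem Judgement.subst_subst {n m l : ℕ} (J : Judgement S n) (σ : Sub S n m) (τ : Sub S m l) :
    (J.subst σ).subst τ = J.subst (σ.comp τ) := by
  cases J <;> simp only [Judgement.subst, Expr.subst_subst]

theorem Judgement.subst_id {n : ℕ} (J : Judgement S n) : J.subst (Sub.id S n) = J := by
  cases J <;> simp only [Judgement.subst, Expr.subst_id]

end SubstitutionLemmas

/-! ### Context morphisms -/

namespace TypeTheory

variable {S : Signature.{u}} (T : TypeTheory S)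

/-- `T.IsMor Δ Γ t`: the terms `t` form a context morphism `Δ → Γ`, that is
`t₀ ∈ A₀, t₁ ∈ A₁(t₀), …` are derivable in context `Δ`. -/
def IsMor {m : ℕ} (Δ : Ctx S m) : ∀ {n : ℕ}, Ctx S n → Sub S n m → Prop
  | _, .nil, _ => True
  | _, .snoc Γ A, t => IsMor Δ Γ t.tail ∧ T.Derivable Δ (.hasType (t 0) (A.subst t.tail))

/-- `T.MorEq Δ Γ s t`: the equations `s₀ = t₀ ∈ A₀, s₁ = t₁ ∈ A₁(s₀), …` are derivable in
context `Δ`. -/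
def MorEq {m : ℕ} (Δ : Ctx S m) : ∀ {n : ℕ}, Ctx S n → Sub S n m → Sub S n m → Prop
  | _, .nil, _, _ => True
  | _, .snoc Γ A, s, t =>
    MorEq Δ Γ s.tail t.tail ∧ T.Derivable Δ (.eqTerm (s 0) (t 0) (A.subst s.tail))

/-- `T.CtxEq Γ Γ'`: two contexts of the same length are identified if
`A₀ = B₀ ∈ Type [], A₁ = B₁ ∈ Type [x₀ ∈ A₀], …` are derivable. -/
def CtxEq : ∀ {n : ℕ}, Ctx S n → Ctx S n → Prop
  | _, .nil, .nil => True
  | _, .snoc Γ A, .snoc Γ' A' => CtxEq Γ Γ' ∧ T.Derivable Γ (.eqType A A')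

variable {T}

theorem weaken {n : ℕ} {Γ : Ctx S n} {A : Ty S n} {J : Judgement S n}
    (h : T.Derivable Γ J) (hA : T.Derivable Γ (.isType A)) :
    T.Derivable (Γ.snoc A) (J.subst (Sub.wk S n)) :=
  T.weakening (n := n) (k := 0) (Γ := Γ) (Ξ := .nil) (J := J) h hA

theorem subst_inst {n : ℕ} {Γ : Ctx S n} {A : Ty S n} {J : Judgement S (n + 1)} {a : Tm S n}
    (h : T.Derivable (Γ.snoc A) J) (ha : T.Derivable Γ (.hasType a A)) :
    T.Derivable Γ (J.subst (Sub.inst a)) :=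
  T.substitution (n := n) (k := 0) (Γ := Γ) (A := A) (Ξ := .nil) (J := J) h ha

theorem subst_aux_nil {m k : ℕ} {Δ : Ctx S m} (hΔ : T.WF Δ) {Ξ : Tel S 0 k}
    {J : Judgement S (extend 0 k)} (h : T.Derivable (Ctx.nil.append Ξ) J) (t : Sub S 0 m) :
    T.Derivable (Δ.append (Ξ.subst t)) (J.subst (t.liftN k)) := by
  induction Δ with
  | nil =>
    have ht : t = Sub.id S 0 := funext fun i => i.elim0
    subst ht
    rw [Tel.subst_id, Sub.liftN_id, Judgement.subst_id]
    exact h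
  | @snoc m Δ A ih =>
    have h1 := T.weakening (ih hΔ.1 (fun i => i.elim0)) hΔ.2
    rw [Tel.subst_subst, Judgement.subst_subst, Sub.liftN_comp] at h1
    have ht : t = Sub.comp (fun i => i.elim0) (Sub.wk S m) := funext fun i => i.elim0
    rw [ht]
    exact h1

theorem subst_aux {m : ℕ} {Δ : Ctx S m} (hΔ : T.WF Δ) {n : ℕ} {Γ : Ctx S n} :
    ∀ {k : ℕ} {Ξ : Tel S n k} {J : Judgement S (extend n k)} {t : Sub S n m},
      T.IsMor Δ Γ t → T.Derivable (Γ.append Ξ) J →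
      T.Derivable (Δ.append (Ξ.subst t)) (J.subst (t.liftN k)) := by
  induction Γ with
  | nil => intro k Ξ J t _ h; exact subst_aux_nil hΔ h t
  | @snoc n Γ A ih =>
    intro k Ξ J t ht h
    have h1 : T.Derivable ((Δ.snoc (A.subst t.tail)).append (Ξ.subst t.tail.lift))
        (J.subst (t.tail.lift.liftN k)) := ih (k := k + 1) (Ξ := .cons A Ξ) ht.1 h
    have h2 := T.substitution h1 ht.2
    rw [Tel.subst_subst, Judgement.subst_subst, Sub.liftN_comp, Sub.lift_comp_inst,
      Sub.cons_tail] at h2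
    exact h2

/-- Derivable statements are stable under substitution along context morphisms. -/
theorem subst_mor {m n : ℕ} {Δ : Ctx S m} {Γ : Ctx S n} (hΔ : T.WF Δ) {J : Judgement S n}
    {t : Sub S n m} (ht : T.IsMor Δ Γ t) (h : T.Derivable Γ J) : T.Derivable Δ (J.subst t) :=
  subst_aux (k := 0) (Ξ := .nil) hΔ ht h

theorem IsMor.comp {l m n : ℕ} {Θ : Ctx S l} {Δ : Ctx S m} {Γ : Ctx S n} (hΘ : T.WF Θ)
    {t : Sub S n m} {s : Sub S m l} (ht : T.IsMor Δ Γ t) (hs : T.IsMor Θ Δ s) :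
    T.IsMor Θ Γ (t.comp s) := by
  induction Γ with
  | nil => trivial
  | snoc Γ A ih =>
    refine ⟨ih ht.1, ?_⟩
    have := subst_mor hΘ hs ht.2
    simp only [Judgement.subst, Expr.subst_subst] at this
    exact this

theorem IsMor.wk {m n : ℕ} {Δ : Ctx S m} {Γ : Ctx S n} {A : Ty S m}
    (hA : T.Derivable Δ (.isType A)) {t : Sub S n m} (ht : T.IsMor Δ Γ t) :
    T.IsMor (Δ.snoc A) Γ (t.comp (Sub.wk S m)) := by
  induction Γ with
  | nil => trivial
  | snoc Γ B ih =>
    refine ⟨ih ht.1, ?_⟩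
    have := weaken ht.2 hA
    simp only [Judgement.subst, Expr.subst_subst] at this
    exact this

theorem isMor_of_ctxEq : ∀ {n : ℕ} {Γ Γ' : Ctx S n}, T.WF Γ' → T.CtxEq Γ Γ' →
    T.IsMor Γ' Γ (Sub.id S n)
  | _, .nil, .nil, _, _ => trivial
  | _, .snoc Γ A, .snoc Γ' A', hw, h => by
    have ih := isMor_of_ctxEq hw.1 h.1
    refine ⟨IsMor.wk hw.2 ih, ?_⟩
    have e := subst_mor hw.1 ih h.2
    rw [Judgement.subst_id] at e
    exact T.conv_hasType (T.var_rule hw.2) (T.type_symm (weaken e hw.2))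

theorem ctx_conv {n : ℕ} {Γ Γ' : Ctx S n} (hw : T.WF Γ') (h : T.CtxEq Γ Γ')
    {J : Judgement S n} (hJ : T.Derivable Γ J) : T.Derivable Γ' J := by
  have := subst_mor hw (isMor_of_ctxEq hw h) hJ
  rwa [Judgement.subst_id] at this

theorem CtxEq.refl : ∀ {n : ℕ} {Γ : Ctx S n}, T.WF Γ → T.CtxEq Γ Γ
  | _, .nil, _ => trivial
  | _, .snoc _ _, h => ⟨CtxEq.refl h.1, T.type_refl h.2⟩

theorem CtxEq.symm : ∀ {n : ℕ} {Γ Γ' : Ctx S n}, T.WF Γ' → T.CtxEq Γ Γ' → T.CtxEq Γ' Γ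
  | _, .nil, .nil, _, _ => trivial
  | _, .snoc _ _, .snoc _ _, hw, h =>
    ⟨CtxEq.symm hw.1 h.1, ctx_conv hw.1 h.1 (T.type_symm h.2)⟩

theorem CtxEq.trans : ∀ {n : ℕ} {Γ Γ' Γ'' : Ctx S n}, T.WF Γ → T.WF Γ' →
    T.CtxEq Γ Γ' → T.CtxEq Γ' Γ'' → T.CtxEq Γ Γ''
  | _, .nil, .nil, .nil, _, _, _, _ => trivial
  | _, .snoc _ _, .snoc _ _, .snoc _ _, hw, hw', h, h' =>
    ⟨CtxEq.trans hw.1 hw'.1 h.1 h'.1,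
      T.type_trans h.2 (ctx_conv hw.1 (CtxEq.symm hw'.1 h.1) h'.2)⟩

theorem wf_of_derivable : ∀ {n : ℕ} {Γ : Ctx S n} {J : Judgement S n},
    T.Derivable Γ J → T.WF Γ
  | _, .nil, _, _ => trivial
  | _, .snoc _ _, _, h => ⟨wf_of_derivable (T.presup_ctx h), T.presup_ctx h⟩

theorem wf_of_append : ∀ {k n : ℕ} {Γ : Ctx S n} {Ξ : Tel S n k},
    T.WF (Γ.append Ξ) → T.WF Γ
  | _, _, _, .nil, h => h
  | _, _, _, .cons _ Ξ, h => (wf_of_append (Ξ := Ξ) h).1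

theorem CtxEq.append : ∀ {k n : ℕ} {Γ Γ' : Ctx S n} {Ξ : Tel S n k},
    T.WF (Γ.append Ξ) → T.CtxEq Γ Γ' → T.CtxEq (Γ.append Ξ) (Γ'.append Ξ)
  | _, _, _, _, .nil, _, h => h
  | _, _, _, _, .cons _ Ξ, hw, h =>
    CtxEq.append (Ξ := Ξ) hw ⟨h, T.type_refl (wf_of_append (Ξ := Ξ) hw).2⟩

variable (T) in
/-- Substituting `s` and `t` in types over extensions of `Γ` gives equal types. -/
def CongrTy {n m : ℕ} (Γ : Ctx S n) (Δ : Ctx S m) (s t : Sub S n m) : Prop :=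
  ∀ ⦃k : ℕ⦄ ⦃Ξ : Tel S n k⦄ ⦃B : Ty S (extend n k)⦄, T.Derivable (Γ.append Ξ) (.isType B) →
    T.Derivable (Δ.append (Ξ.subst s)) (.eqType (B.subst (s.liftN k)) (B.subst (t.liftN k)))

variable (T) in
/-- Substituting `s` and `t` in terms over extensions of `Γ` gives equal terms. -/
def CongrTm {n m : ℕ} (Γ : Ctx S n) (Δ : Ctx S m) (s t : Sub S n m) : Prop :=
  ∀ ⦃k : ℕ⦄ ⦃Ξ : Tel S n k⦄ ⦃b : Tm S (extend n k)⦄ ⦃B : Ty S (extend n k)⦄,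
    T.Derivable (Γ.append Ξ) (.hasType b B) →
    T.Derivable (Δ.append (Ξ.subst s))
      (.eqTerm (b.subst (s.liftN k)) (b.subst (t.liftN k)) (B.subst (s.liftN k)))

theorem CongrTy.ctxEq : ∀ {k n m : ℕ} {Γ : Ctx S n} {Δ Δ' : Ctx S m} {s t : Sub S n m}
    {Ξ : Tel S n k}, T.CongrTy Γ Δ s t → T.WF (Γ.append Ξ) → T.CtxEq Δ Δ' →
    T.CtxEq (Δ.append (Ξ.subst s)) (Δ'.append (Ξ.subst t))
  | _, _, _, _, _, _, _, _, .nil, _, _, h => h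
  | _, n, m, Γ, Δ, Δ', s, t, .cons A Ξ, hc, hw, h => by
    have hA : T.Derivable Δ (.eqType (A.subst s) (A.subst t)) :=
      hc (k := 0) (Ξ := .nil) (wf_of_append (n := n + 1) (Γ := Γ.snoc A) (Ξ := Ξ) hw).2
    have hc' : T.CongrTy (Γ.snoc A) (Δ.snoc (A.subst s)) s.lift t.lift :=
      fun k Θ B hB => hc (k := k + 1) (Ξ := .cons A Θ) hB
    exact CongrTy.ctxEq (n := n + 1) (Γ := Γ.snoc A) (Δ := Δ.snoc (A.subst s))
      (Δ' := Δ'.snoc (A.subst t)) (Ξ := Ξ) hc' hw ⟨h, hA⟩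

theorem congrTy_inst {m : ℕ} {Δ : Ctx S m} {A : Ty S m} {a b : Tm S m}
    (h : T.Derivable Δ (.eqTerm a b A)) : T.CongrTy (Δ.snoc A) Δ (Sub.inst a) (Sub.inst b) :=
  fun _ _ _ hB => T.subst_congr_type hB h

theorem MorEq.congr {m n : ℕ} {Δ : Ctx S m} (hΔ : T.WF Δ) {Γ : Ctx S n} :
    ∀ {s t : Sub S n m}, T.IsMor Δ Γ s → T.MorEq Δ Γ s t →
      T.CongrTy Γ Δ s t ∧ T.CongrTm Γ Δ s t := by
  induction Γ with
  | nil =>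
    intro s t hs _
    have hst : s = t := funext fun i => i.elim0
    subst hst
    exact ⟨fun k Ξ B hB => T.type_refl (subst_aux hΔ hs hB),
      fun k Ξ b B hb => T.term_refl (subst_aux hΔ hs hb)⟩
  | @snoc n Γ A ih =>
    intro s t hs h
    obtain ⟨ih1, ih2⟩ := ih hs.1 h.1
    have hb0 : T.Derivable Δ (.hasType (t 0) (A.subst s.tail)) :=
      T.presup_eqTerm (T.term_symm h.2)
    -- substitution into the extension of `Δ` by `A`
    have key : ∀ {k : ℕ} {Ξ : Tel S (n + 1) k} {J : Judgement S (extend (n + 1) k)},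
        T.Derivable ((Γ.snoc A).append Ξ) J →
        T.Derivable ((Δ.snoc (A.subst s.tail)).append (Ξ.subst s.tail.lift))
          (J.subst (s.tail.lift.liftN k)) := fun {k Ξ J} hJ =>
      subst_aux (k := k + 1) (Ξ := .cons A Ξ) hΔ hs.1 hJ
    have conv : ∀ {k : ℕ} {Ξ : Tel S (n + 1) k} {J : Judgement S (extend (n + 1) k)}
        {K : Judgement S (extend m k)},
        T.Derivable ((Γ.snoc A).append Ξ) J →
        T.Derivable (Δ.append (Ξ.subst (s.tail.cons (t 0)))) K →
        T.Derivable (Δ.append (Ξ.subst s)) K := by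
      intro k Ξ J K hJ hK
      have hw := wf_of_derivable (key hJ)
      have e := CongrTy.ctxEq (congrTy_inst (T.term_symm h.2)) hw (CtxEq.refl hΔ)
      have hw' := wf_of_derivable (T.substitution (key hJ) hs.2)
      rw [Tel.subst_subst, Tel.subst_subst, Sub.lift_comp_inst, Sub.lift_comp_inst,
        Sub.cons_tail] at e
      rw [Tel.subst_subst, Sub.lift_comp_inst, Sub.cons_tail] at hw'
      exact ctx_conv hw' e hK
    have ty1 : ∀ {k : ℕ} {Ξ : Tel S (n + 1) k} {B : Ty S (extend (n + 1) k)},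
        T.Derivable ((Γ.snoc A).append Ξ) (.isType B) →
        T.Derivable (Δ.append (Ξ.subst s))
          (.eqType (B.subst (s.liftN k)) (B.subst ((s.tail.cons (t 0)).liftN k))) := by
      intro k Ξ B hB
      have e := T.subst_congr_type (key hB) h.2
      rw [Tel.subst_subst, Expr.subst_subst, Expr.subst_subst, Sub.liftN_comp, Sub.liftN_comp,
        Sub.lift_comp_inst, Sub.lift_comp_inst, Sub.cons_tail] at e
      exact e
    refine ⟨fun k Ξ B hB => T.type_trans (ty1 hB) (conv hB ?_),
      fun k Ξ b B hb => ?_⟩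
    · have e : T.Derivable ((Δ.snoc (A.subst s.tail)).append (Ξ.subst s.tail.lift))
          (.eqType (B.subst (s.tail.lift.liftN k)) (B.subst (t.tail.lift.liftN k))) :=
        ih1 (k := k + 1) (Ξ := .cons A Ξ) hB
      have e' := T.substitution e hb0
      simp only [Judgement.subst] at e'
      rw [Tel.subst_subst, Expr.subst_subst, Expr.subst_subst, Sub.liftN_comp, Sub.liftN_comp,
        Sub.lift_comp_inst, Sub.lift_comp_inst, Sub.cons_tail] at e'
      exact e'
    · have hB := T.presup_hasType hb
      have e1 := T.subst_congr_term (key hb) h.2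
      rw [Tel.subst_subst, Expr.subst_subst, Expr.subst_subst, Expr.subst_subst, Sub.liftN_comp,
        Sub.liftN_comp, Sub.lift_comp_inst, Sub.lift_comp_inst, Sub.cons_tail] at e1
      have e : T.Derivable ((Δ.snoc (A.subst s.tail)).append (Ξ.subst s.tail.lift))
          (.eqTerm (b.subst (s.tail.lift.liftN k)) (b.subst (t.tail.lift.liftN k))
            (B.subst (s.tail.lift.liftN k))) :=
        ih2 (k := k + 1) (Ξ := .cons A Ξ) hb
      have e' := T.substitution e hb0
      simp only [Judgement.subst] at e'
      rw [Tel.subst_subst, Expr.subst_subst, Expr.subst_subst, Expr.subst_subst, Sub.liftN_comp,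
        Sub.liftN_comp, Sub.lift_comp_inst, Sub.lift_comp_inst, Sub.cons_tail] at e'
      exact T.term_trans e1
        (T.conv_eqTerm (conv hb e') (T.type_symm (ty1 hB)))

theorem MorEq.subst_type {m n : ℕ} {Δ : Ctx S m} {Γ : Ctx S n} (hΔ : T.WF Δ) {s t : Sub S n m}
    (hs : T.IsMor Δ Γ s) (h : T.MorEq Δ Γ s t) {B : Ty S n} (hB : T.Derivable Γ (.isType B)) :
    T.Derivable Δ (.eqType (B.subst s) (B.subst t)) :=
  (MorEq.congr hΔ hs h).1 (k := 0) (Ξ := .nil) hB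

theorem MorEq.subst_term {m n : ℕ} {Δ : Ctx S m} {Γ : Ctx S n} (hΔ : T.WF Δ) {s t : Sub S n m}
    (hs : T.IsMor Δ Γ s) (h : T.MorEq Δ Γ s t) {b : Tm S n} {B : Ty S n}
    (hb : T.Derivable Γ (.hasType b B)) :
    T.Derivable Δ (.eqTerm (b.subst s) (b.subst t) (B.subst s)) :=
  (MorEq.congr hΔ hs h).2 (k := 0) (Ξ := .nil) hb

theorem MorEq.refl {m n : ℕ} {Δ : Ctx S m} {Γ : Ctx S n} {s : Sub S n m}
    (hs : T.IsMor Δ Γ s) : T.MorEq Δ Γ s s := by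
  induction Γ with
  | nil => trivial
  | snoc Γ A ih => exact ⟨ih hs.1, T.term_refl hs.2⟩

theorem MorEq.symm {m n : ℕ} {Δ : Ctx S m} {Γ : Ctx S n} (hΔ : T.WF Δ) (hΓ : T.WF Γ)
    {s t : Sub S n m} (hs : T.IsMor Δ Γ s) (h : T.MorEq Δ Γ s t) : T.MorEq Δ Γ t s := by
  induction Γ with
  | nil => trivial
  | snoc Γ A ih =>
    exact ⟨ih hΓ.1 hs.1 h.1,
      T.conv_eqTerm (T.term_symm h.2) (MorEq.subst_type hΔ hs.1 h.1 hΓ.2)⟩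

theorem MorEq.trans {m n : ℕ} {Δ : Ctx S m} {Γ : Ctx S n} (hΔ : T.WF Δ) (hΓ : T.WF Γ)
    {s t w : Sub S n m} (hs : T.IsMor Δ Γ s) (h : T.MorEq Δ Γ s t) (h' : T.MorEq Δ Γ t w) :
    T.MorEq Δ Γ s w := by
  induction Γ with
  | nil => trivial
  | snoc Γ A ih =>
    exact ⟨ih hΓ.1 hs.1 h.1 h'.1, T.term_trans h.2
      (T.conv_eqTerm h'.2 (T.type_symm (MorEq.subst_type hΔ hs.1 h.1 hΓ.2)))⟩

theorem MorEq.comp_left {l m n : ℕ} {Θ : Ctx S l} {Δ : Ctx S m} {Γ : Ctx S n} (hΘ : T.WF Θ)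
    {t t' : Sub S n m} {s : Sub S m l} (hs : T.IsMor Θ Δ s) (h : T.MorEq Δ Γ t t') :
    T.MorEq Θ Γ (t.comp s) (t'.comp s) := by
  induction Γ with
  | nil => trivial
  | snoc Γ A ih =>
    refine ⟨ih h.1, ?_⟩
    have := subst_mor hΘ hs h.2
    simp only [Judgement.subst, Expr.subst_subst] at this
    exact this

theorem MorEq.comp_right {l m n : ℕ} {Θ : Ctx S l} {Δ : Ctx S m} {Γ : Ctx S n} (hΘ : T.WF Θ)
    {t : Sub S n m} {s s' : Sub S m l} (ht : T.IsMor Δ Γ t) (hs : T.IsMor Θ Δ s)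
    (h : T.MorEq Θ Δ s s') : T.MorEq Θ Γ (t.comp s) (t.comp s') := by
  induction Γ with
  | nil => trivial
  | snoc Γ A ih =>
    refine ⟨ih ht.1, ?_⟩
    have := MorEq.subst_term hΘ hs h ht.2
    rw [Expr.subst_subst] at this
    exact this

theorem IsMor.congr_ctx {m n : ℕ} {Δ Δ' : Ctx S m} {Γ Γ' : Ctx S n} (hΔ' : T.WF Δ')
    (hΓ : T.WF Γ) (hΓ' : T.WF Γ') (h : T.CtxEq Δ Δ') (h' : T.CtxEq Γ Γ') {t : Sub S n m}
    (ht : T.IsMor Δ Γ t) : T.IsMor Δ' Γ' t := by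
  have h1 : T.IsMor Δ' Γ t := by
    have := IsMor.comp hΔ' ht (isMor_of_ctxEq hΔ' h)
    rwa [Sub.comp_id] at this
  have := IsMor.comp hΔ' (isMor_of_ctxEq hΓ (CtxEq.symm hΓ' h')) h1
  rwa [Sub.id_comp] at this

theorem MorEq.congr_ctx {m n : ℕ} {Δ Δ' : Ctx S m} {Γ Γ' : Ctx S n} (hΔ' : T.WF Δ')
    (hΓ : T.WF Γ) (hΓ' : T.WF Γ') (h : T.CtxEq Δ Δ') (h' : T.CtxEq Γ Γ') {s t : Sub S n m}
    (hs : T.IsMor Δ Γ s) (hst : T.MorEq Δ Γ s t) : T.MorEq Δ' Γ' s t := by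
  have h1 : T.MorEq Δ' Γ s t := by
    have := MorEq.comp_left hΔ' (isMor_of_ctxEq hΔ' h) hst
    rwa [Sub.comp_id, Sub.comp_id] at this
  have h2 : T.IsMor Δ' Γ s := IsMor.congr_ctx hΔ' hΓ hΓ h (CtxEq.refl hΓ) hs
  have := MorEq.comp_right hΔ' (isMor_of_ctxEq hΓ (CtxEq.symm hΓ' h')) h2 h1
  rwa [Sub.id_comp, Sub.id_comp] at this

theorem isMor_id {n : ℕ} {Γ : Ctx S n} (hΓ : T.WF Γ) : T.IsMor Γ Γ (Sub.id S n) :=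
  isMor_of_ctxEq hΓ (CtxEq.refl hΓ)

theorem isMor_wk {n : ℕ} {Γ : Ctx S n} {A : Ty S n} (h : T.WF (Γ.snoc A)) :
    T.IsMor (Γ.snoc A) Γ (Sub.wk S n) :=
  (isMor_id h).1

/-! ### The classifying category -/

variable (T)

/-- Well-formed contexts of length `n`. -/
def WFCtx (n : ℕ) : Type u := {Γ : Ctx S n // T.WF Γ}

/-- Identification of contexts of the same length. -/
instance ctxSetoid (n : ℕ) : Setoid (T.WFCtx n) where
  r Γ Γ' := T.CtxEq Γ.1 Γ'.1
  iseqv :=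
    { refl := fun Γ => CtxEq.refl Γ.2
      symm := fun {_ Γ'} h => CtxEq.symm Γ'.2 h
      trans := fun {Γ Γ' _} h h' => CtxEq.trans Γ.2 Γ'.2 h h' }

/-- The objects of the classifying category: equivalence classes of contexts. -/
def ClassifyingCategory : Type u := Σ n : ℕ, Quotient (T.ctxSetoid n)

namespace ClassifyingCategory

variable {T}

/-- The object given by a context. -/
def mk {n : ℕ} (Γ : Ctx S n) (hΓ : T.WF Γ) : T.ClassifyingCategory :=
  ⟨n, Quotient.mk (T.ctxSetoid n) ⟨Γ, hΓ⟩⟩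

/-- The sequences of terms which represent a morphism from `X` to `Y`. -/
def IsHom (X Y : T.ClassifyingCategory) (t : Sub S Y.1 X.1) : Prop :=
  Quotient.lift₂ (fun (Δ : T.WFCtx X.1) (Γ : T.WFCtx Y.1) => T.IsMor Δ.1 Γ.1 t)
    (fun Δ Γ Δ' Γ' h h' => propext
      ⟨IsMor.congr_ctx Δ'.2 Γ.2 Γ'.2 h h',
        IsMor.congr_ctx Δ.2 Γ'.2 Γ.2 (CtxEq.symm Δ'.2 h) (CtxEq.symm Γ'.2 h')⟩) X.2 Y.2

/-- The sequences of terms which represent a morphism from `X` to `Y`, as a type. -/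
def PreHom (X Y : T.ClassifyingCategory) : Type u := {t : Sub S Y.1 X.1 // IsHom X Y t}

/-- Identification of sequences of terms representing a morphism from `X` to `Y`. -/
def HomEq (X Y : T.ClassifyingCategory) (s t : PreHom X Y) : Prop :=
  ∃ (Δ : T.WFCtx X.1) (Γ : T.WFCtx Y.1), Quotient.mk _ Δ = X.2 ∧ Quotient.mk _ Γ = Y.2 ∧
    T.MorEq Δ.1 Γ.1 s.1 t.1

theorem homEq_mk {m n : ℕ} {Δ : T.WFCtx m} {Γ : T.WFCtx n}
    {s t : PreHom (T := T) ⟨m, Quotient.mk _ Δ⟩ ⟨n, Quotient.mk _ Γ⟩} :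
    HomEq _ _ s t ↔ T.MorEq Δ.1 Γ.1 s.1 t.1 := by
  constructor
  · rintro ⟨Δ', Γ', h, h', e⟩
    have h1 : T.CtxEq Δ'.1 Δ.1 := Quotient.exact h
    have h2 : T.CtxEq Γ'.1 Γ.1 := Quotient.exact h'
    have hs : T.IsMor Δ.1 Γ.1 s.1 := s.2
    exact MorEq.congr_ctx Δ.2 Γ'.2 Γ.2 h1 h2
      (IsMor.congr_ctx Δ'.2 Γ.2 Γ'.2 (CtxEq.symm Δ.2 h1) (CtxEq.symm Γ.2 h2) hs) e
  · intro e
    exact ⟨Δ, Γ, rfl, rfl, e⟩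

instance homSetoid (X Y : T.ClassifyingCategory) : Setoid (PreHom X Y) where
  r := HomEq X Y
  iseqv := by
    obtain ⟨m, X⟩ := X
    obtain ⟨n, Y⟩ := Y
    induction X using Quotient.ind with | _ Δ => ?_
    induction Y using Quotient.ind with | _ Γ => ?_
    exact
      { refl := fun s => homEq_mk.2 (MorEq.refl s.2)
        symm := fun {s t} h => homEq_mk.2 (MorEq.symm Δ.2 Γ.2 s.2 (homEq_mk.1 h))
        trans := fun {s t w} h h' =>
          homEq_mk.2 (MorEq.trans Δ.2 Γ.2 s.2 (homEq_mk.1 h) (homEq_mk.1 h')) }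

/-- Morphisms of the classifying category: equivalence classes of sequences of terms. -/
def Hom (X Y : T.ClassifyingCategory) : Type u := Quotient (homSetoid X Y)

/-- The identity morphism is represented by the sequence of variables. -/
def preId (X : T.ClassifyingCategory) : PreHom X X :=
  ⟨Sub.id S X.1, by
    obtain ⟨m, X⟩ := X
    induction X using Quotient.ind with | _ Γ => exact isMor_id Γ.2⟩

/-- Composition is given by substitution. -/
def preComp {X Y Z : T.ClassifyingCategory} (s : PreHom X Y) (t : PreHom Y Z) : PreHom X Z :=
  ⟨t.1.comp s.1, by
    obtain ⟨l, X⟩ := X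
    obtain ⟨m, Y⟩ := Y
    obtain ⟨n, Z⟩ := Z
    induction X using Quotient.ind with | _ Θ => ?_
    induction Y using Quotient.ind with | _ Δ => ?_
    induction Z using Quotient.ind with | _ Γ => ?_
    exact IsMor.comp Θ.2 (Δ := Δ.1) t.2 s.2⟩

theorem preComp_congr {X Y Z : T.ClassifyingCategory} {s s' : PreHom X Y} {t t' : PreHom Y Z}
    (hs : HomEq X Y s s') (ht : HomEq Y Z t t') : HomEq X Z (preComp s t) (preComp s' t') := by
  obtain ⟨l, X⟩ := X
  obtain ⟨m, Y⟩ := Y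
  obtain ⟨n, Z⟩ := Z
  induction X using Quotient.ind with | _ Θ => ?_
  induction Y using Quotient.ind with | _ Δ => ?_
  induction Z using Quotient.ind with | _ Γ => ?_
  rw [homEq_mk] at hs ht ⊢
  have h1 : T.IsMor Θ.1 Δ.1 s.1 := s.2
  have h1' : T.IsMor Θ.1 Δ.1 s'.1 := s'.2
  have h2 : T.IsMor Δ.1 Γ.1 t.1 := t.2
  exact MorEq.trans Θ.2 Γ.2 (IsMor.comp Θ.2 h2 h1) (MorEq.comp_right Θ.2 h2 h1 hs)
    (MorEq.comp_left Θ.2 h1' ht)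

/-- The classifying category of the type theory `T`. -/
instance category : Category.{u} T.ClassifyingCategory where
  Hom := Hom
  id X := Quotient.mk _ (preId X)
  comp {X Y Z} := Quotient.map₂ preComp (fun _ _ hs _ _ ht => preComp_congr hs ht)
  id_comp {X Y} f := by
    induction f using Quotient.ind with | _ t => ?_
    exact congrArg (Quotient.mk _) (Subtype.ext (Sub.comp_id t.1))
  comp_id {X Y} f := by
    induction f using Quotient.ind with | _ t => ?_
    exact congrArg (Quotient.mk _) (Subtype.ext (Sub.id_comp t.1))
  assoc {W X Y Z} f g h := by
    induction f using Quotient.ind with | _ s => ?_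
    induction g using Quotient.ind with | _ t => ?_
    induction h using Quotient.ind with | _ w => ?_
    exact congrArg (Quotient.mk _) (Subtype.ext (Sub.comp_assoc w.1 t.1 s.1).symm)

/-- The morphism given by a sequence of terms. -/
def homMk {m n : ℕ} {Δ : Ctx S m} {Γ : Ctx S n} (hΔ : T.WF Δ) (hΓ : T.WF Γ) (t : Sub S n m)
    (ht : T.IsMor Δ Γ t) : mk Δ hΔ ⟶ mk Γ hΓ :=
  Quotient.mk (homSetoid (mk Δ hΔ) (mk Γ hΓ)) ⟨t, ht⟩

/-- The map `[Γ, x ∈ A] → Γ` dropping the last type. -/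
def proj {n : ℕ} (Γ : Ctx S n) (A : Ty S n) (h : T.WF (Γ.snoc A)) :
    mk (Γ.snoc A) h ⟶ mk Γ h.1 :=
  homMk h h.1 (Sub.wk S n) (isMor_wk h)

end ClassifyingCategory

open ClassifyingCategory

/-- The display maps. -/
inductive displayMaps : MorphismProperty T.ClassifyingCategory
  | proj {n : ℕ} (Γ : Ctx S n) (A : Ty S n) (h : T.WF (Γ.snoc A)) :
      displayMaps (ClassifyingCategory.proj Γ A h)

/-- The dependent projections: the closure of the display maps under identities and composition. -/
def dependentProjections : MorphismProperty T.ClassifyingCategory :=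
  T.displayMaps.multiplicativeClosure

/-- The fibrations: the morphisms isomorphic to dependent projections. -/
def fibrations : MorphismProperty T.ClassifyingCategory :=
  T.dependentProjections.isoClosure

end TypeTheory

namespace PropositionalIdTypes

open TypeTheory TypeTheory.ClassifyingCategory

variable {S : Signature.{u}} {T : TypeTheory S} (I : PropositionalIdTypes T)

theorem wf_nil_snoc {A : Ty S 0} (hA : T.Derivable .nil (.isType A)) :
    T.WF (Ctx.nil.snoc A) := ⟨trivial, hA⟩

theorem wf_idCtx {n : ℕ} {Γ : Ctx S n} {A : Ty S n} (hA : T.Derivable Γ (.isType A)) :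
    T.WF (idCtx I.Id Γ A) := by
  have h1 := weaken hA hA
  exact ⟨⟨⟨wf_of_derivable hA, hA⟩, h1⟩, I.Id_form (weaken (T.var_rule hA) h1) (T.var_rule h1)⟩

theorem isMor_src {A : Ty S 0} (hA : T.Derivable .nil (.isType A)) :
    T.IsMor (idCtx I.Id .nil A) (Ctx.nil.snoc A) (fun _ => .var 2) := by
  have h1 := weaken hA hA
  have h : T.Derivable (idCtx I.Id .nil A) (.hasType (.var 2)
      (((A.subst (Sub.wk S 0)).subst (Sub.wk S 1)).subst (Sub.wk S 2))) :=
    weaken (weaken (T.var_rule hA) h1) (I.wf_idCtx hA).2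
  rw [Expr.subst_subst, Expr.subst_subst] at h
  refine ⟨trivial, ?_⟩
  have e : Sub.tail (fun _ => .var 2) = (Sub.wk S 0).comp ((Sub.wk S 1).comp (Sub.wk S 2)) :=
    funext fun i => i.elim0
  rw [e]
  exact h

theorem isMor_tgt {A : Ty S 0} (hA : T.Derivable .nil (.isType A)) :
    T.IsMor (idCtx I.Id .nil A) (Ctx.nil.snoc A) (fun _ => .var 1) := by
  have h1 := weaken hA hA
  have h : T.Derivable (idCtx I.Id .nil A) (.hasType (.var 1)
      (((A.subst (Sub.wk S 0)).subst (Sub.wk S 1)).subst (Sub.wk S 2))) :=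
    weaken (T.var_rule h1) (I.wf_idCtx hA).2
  rw [Expr.subst_subst, Expr.subst_subst] at h
  refine ⟨trivial, ?_⟩
  have e : Sub.tail (fun _ => .var 1) = (Sub.wk S 0).comp ((Sub.wk S 1).comp (Sub.wk S 2)) :=
    funext fun i => i.elim0
  rw [e]
  exact h

/-- The object `[x ∈ A]` for a closed type `A`. -/
def typeObj {A : Ty S 0} (hA : T.Derivable .nil (.isType A)) : T.ClassifyingCategory :=
  ClassifyingCategory.mk (Ctx.nil.snoc A) (wf_nil_snoc hA)

/-- The object `[x ∈ A, y ∈ A, u ∈ Id_A(x, y)]` for a closed type `A`. -/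
def pathObj {A : Ty S 0} (hA : T.Derivable .nil (.isType A)) : T.ClassifyingCategory :=
  ClassifyingCategory.mk (idCtx I.Id .nil A) (I.wf_idCtx hA)

/-- The map `(x, y, u) ↦ x`. -/
def src {A : Ty S 0} (hA : T.Derivable .nil (.isType A)) : I.pathObj hA ⟶ typeObj hA :=
  homMk (I.wf_idCtx hA) (wf_nil_snoc hA) (fun _ => .var 2) (I.isMor_src hA)

/-- The map `(x, y, u) ↦ y`. -/
def tgt {A : Ty S 0} (hA : T.Derivable .nil (.isType A)) : I.pathObj hA ⟶ typeObj hA :=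
  homMk (I.wf_idCtx hA) (wf_nil_snoc hA) (fun _ => .var 1) (I.isMor_tgt hA)

/-- Two parallel maps `f, g : X → Y` are homotopic if, after identifying `Y` with a closed type
`A` by means of an isomorphism, they are propositionally equal as elements of type `A`. -/
def Homotopic {X Y : T.ClassifyingCategory} (f g : X ⟶ Y) : Prop :=
  ∃ (A : Ty S 0) (hA : T.Derivable .nil (.isType A)) (e : Y ≅ typeObj hA)
    (h : X ⟶ I.pathObj hA), h ≫ I.src hA = f ≫ e.hom ∧ h ≫ I.tgt hA = g ≫ e.hom

/-- The homotopy equivalences. -/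
def homotopyEquivalences : MorphismProperty T.ClassifyingCategory :=
  fun X Y f => ∃ g : Y ⟶ X, I.Homotopic (f ≫ g) (𝟙 X) ∧ I.Homotopic (g ≫ f) (𝟙 Y)

end PropositionalIdTypes

/-! ### Path categories -/

/-- A path object on `B`, relative to classes of weak equivalences and fibrations: a factorisation
of the diagonal `B → B × B` as a weak equivalence followed by a fibration. -/
structure PathObject {C : Type u} [Category.{v} C] (weq fib : MorphismProperty C) (B : C) where
  prod : BinaryFan B B
  isLimit : IsLimit prod
  obj : C
  r : B ⟶ obj
  st : obj ⟶ prod.pt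
  weq_r : weq r
  fib_st : fib st
  fac_fst : r ≫ st ≫ prod.fst = 𝟙 B
  fac_snd : r ≫ st ≫ prod.snd = 𝟙 B

/-- The structure of a path category on a category `C`. -/
structure PathCategory (C : Type u) [Category.{v} C] where
  fib : MorphismProperty C
  weq : MorphismProperty C
  fib_of_isIso : ∀ {X Y : C} (f : X ⟶ Y), IsIso f → fib f
  fib_comp : ∀ {X Y Z : C} (f : X ⟶ Y) (g : Y ⟶ Z), fib f → fib g → fib (f ≫ g)
  hasPullback : ∀ {X Y Z : C} (p : X ⟶ Z) (f : Y ⟶ Z), fib p → HasPullback p f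
  fib_pullback : ∀ {W X Y Z : C} {g : W ⟶ X} {q : W ⟶ Y} {p : X ⟶ Z} {f : Y ⟶ Z},
    IsPullback g q p f → fib p → fib q
  hasTerminal : HasTerminal C
  fib_terminal : ∀ {X Z : C} (f : X ⟶ Z), IsTerminal Z → fib f
  weq_of_isIso : ∀ {X Y : C} (f : X ⟶ Y), IsIso f → weq f
  two_out_of_six : ∀ {A B C' D : C} (f : A ⟶ B) (g : B ⟶ C') (h : C' ⟶ D),
    weq (f ≫ g) → weq (g ≫ h) → weq f ∧ weq g ∧ weq h ∧ weq (f ≫ g ≫ h)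
  pathObject : ∀ B : C, Nonempty (PathObject weq fib B)
  acyclic_section : ∀ {X Y : C} (p : X ⟶ Y), fib p → weq p → ∃ s : Y ⟶ X, s ≫ p = 𝟙 Y
  acyclic_pullback : ∀ {W X Y Z : C} {g : W ⟶ X} {q : W ⟶ Y} {p : X ⟶ Z} {f : Y ⟶ Z},
    IsPullback g q p f → fib p → weq p → fib q ∧ weq q

end DTT

/-! Strong sums collapse a context to a single type. The isomorphism `[Γ, x ∈ A, y ∈ B] ≅ [Γ, z ∈ Σ
x ∈ A. B]` lies over `Γ`, and `[Γ, x ∈ 1] ≅ Γ`. Hence every object is isomorphic to some `[x ∈ A]`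
with `A` closed (`exists_iso_typeObj`), and every fibration over `Γ` is isomorphic over `Γ` to one
display map `[Γ, x ∈ A] → Γ` (`fibrations.exists_iso`). The axioms on fibrations alone then reduce
to display maps, whose pullbacks are given by substitution (`isPullback_proj`).

A map into an object coded by a closed type is a single term, and homotopy becomes inhabitation of
an identity type. The main tool is transport: an element of `B(a)` and an identification of `a` with
`b` give an element of `B(b)` (`hasElement_transport`). It is obtained from path induction with the
element of `B(x)` as a parameter. Symmetry, transitivity and preservation by functions are
transports in suitable families of identity types, so homotopy is a congruence. The homotopy
equivalences are therefore exactly the maps inverted in the quotient category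
(`homotopyEquivalences_iff`), and two-out-of-six is inherited from isomorphisms.

Acyclic fibrations are governed by contractibility: a display map is a homotopy equivalence exactly
when its type has a centre `s` together with an element of `Id(s, x)` over the generic `x`. A
homotopy inverse is at first only a section up to homotopy, and transport along that homotopy turns
it into a strict section. Contractibility consists of derivable terms and so survives substitution.
This yields sections of acyclic fibrations and their stability under pullback.

The path object of `[x ∈ A]` is `[x ∈ A, y ∈ A, u ∈ Id(x, y)]`. Path induction shows that `x ↦ (x,
x, r(x))` is a homotopy equivalence. Throughout, it only matters that an identity type is inhabited,
never by which element. -/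

namespace DTT

/-! ### Further identities between raw substitutions -/

section SubstitutionCalculus

variable {S : Signature.{u}}

theorem Sub.wk_comp {n m : ℕ} (σ : Sub S (n + 1) m) : (Sub.wk S n).comp σ = σ.tail := rfl

theorem Sub.tail_cons {n m : ℕ} (σ : Sub S n m) (a : Tm S m) : (σ.cons a).tail = σ := rfl

theorem Sub.tail_inst {n : ℕ} (a : Tm S n) : (Sub.inst a).tail = Sub.id S n := rfl

theorem Sub.cons_comp {n m l : ℕ} (σ : Sub S n m) (a : Tm S m) (τ : Sub S m l) :
    (σ.cons a).comp τ = (σ.comp τ).cons (a.subst τ) := by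
  funext i; refine Fin.cases rfl (fun _ => rfl) i

theorem Sub.inst_comp {n m : ℕ} (a : Tm S n) (τ : Sub S n m) :
    (Sub.inst a).comp τ = τ.cons (a.subst τ) := by
  unfold Sub.inst
  rw [Sub.cons_comp, Sub.id_comp]

/-- A closed expression has only one instance in each context. Any substitution into a closed type
can therefore be rewritten to `Sub.empty`, which normalises the types of maps into `[x ∈ A]`. -/
instance {m : ℕ} : Subsingleton (Sub S 0 m) := ⟨fun _ _ => funext fun i => i.elim0⟩

/-- The unique substitution for no variables. -/
def Sub.empty (S : Signature.{u}) (m : ℕ) : Sub S 0 m := fun i => i.elim0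

theorem Sub.comp_empty {n m : ℕ} (t : Sub S n m) : (Sub.empty S n).comp t = Sub.empty S m :=
  Subsingleton.elim _ _

theorem Sub.eq_empty_cons {m : ℕ} (t : Sub S 1 m) : t = (Sub.empty S m).cons (t 0) := by
  rw [Subsingleton.elim (Sub.empty S m) t.tail, Sub.cons_tail]

end SubstitutionCalculus

/-! ### Context morphisms and representatives of morphisms -/

namespace TypeTheory

variable {S : Signature.{u}} {T : TypeTheory S}

theorem IsMor.lift {m n : ℕ} {Δ : Ctx S m} {Γ : Ctx S n} (hΔ : T.WF Δ) {t : Sub S n m}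
    (ht : T.IsMor Δ Γ t) {A : Ty S n} (hA : T.Derivable Γ (.isType A)) :
    T.IsMor (Δ.snoc (A.subst t)) (Γ.snoc A) t.lift := by
  have hA' : T.Derivable Δ (.isType (A.subst t)) := subst_mor hΔ ht hA
  refine ⟨?_, ?_⟩
  · rw [Sub.tail_lift]
    exact IsMor.wk hA' ht
  · have := T.var_rule hA'
    rw [Expr.subst_subst] at this
    rw [Sub.tail_lift]
    exact this

theorem IsMor.cons {m n : ℕ} {Δ : Ctx S m} {Γ : Ctx S n} {t : Sub S n m}
    (ht : T.IsMor Δ Γ t) {A : Ty S n} {a : Tm S m} (ha : T.Derivable Δ (.hasType a (A.subst t))) :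
    T.IsMor Δ (Γ.snoc A) (t.cons a) :=
  ⟨ht, ha⟩

theorem isMor_inst {n : ℕ} {Γ : Ctx S n} {A : Ty S n} {a : Tm S n}
    (ha : T.Derivable Γ (.hasType a A)) : T.IsMor Γ (Γ.snoc A) (Sub.inst a) :=
  IsMor.cons (isMor_id (wf_of_derivable ha)) (by rwa [Expr.subst_id])

theorem presup_eqTerm_right {n : ℕ} {Γ : Ctx S n} {A : Ty S n} {a b : Tm S n}
    (h : T.Derivable Γ (.eqTerm a b A)) : T.Derivable Γ (.hasType b A) :=
  T.presup_eqTerm (T.term_symm h)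

/-! ### Morphisms of the classifying category -/

namespace ClassifyingCategory

theorem exists_eq_mk (X : T.ClassifyingCategory) :
    ∃ (n : ℕ) (Γ : Ctx S n) (hΓ : T.WF Γ), X = mk Γ hΓ := by
  obtain ⟨n, X⟩ := X
  induction X using Quotient.ind with | _ Γ => exact ⟨n, Γ.1, Γ.2, rfl⟩

section

variable {l m n : ℕ} {Θ : Ctx S l} {Δ : Ctx S m} {Γ : Ctx S n} {hΘ : T.WF Θ} {hΔ : T.WF Δ}
  {hΓ : T.WF Γ}

theorem exists_eq_homMk (f : mk Δ hΔ ⟶ mk Γ hΓ) :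
    ∃ (t : Sub S n m) (ht : T.IsMor Δ Γ t), f = homMk hΔ hΓ t ht := by
  induction f using Quotient.ind with | _ t => exact ⟨t.1, t.2, rfl⟩

/-- The passage from equations between morphisms to derivable equations between terms; all diagram
identities below are checked through it unless they already hold for raw substitutions. -/
theorem homMk_eq_iff {s t : Sub S n m} {hs : T.IsMor Δ Γ s} {ht : T.IsMor Δ Γ t} :
    homMk hΔ hΓ s hs = homMk hΔ hΓ t ht ↔ T.MorEq Δ Γ s t :=
  Quotient.eq.trans homEq_mk

theorem homMk_comp {s : Sub S m l} {hs : T.IsMor Θ Δ s} {t : Sub S n m} {ht : T.IsMor Δ Γ t} :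
    homMk hΘ hΔ s hs ≫ homMk hΔ hΓ t ht = homMk hΘ hΓ (t.comp s) (IsMor.comp hΘ ht hs) :=
  rfl

theorem id_eq_homMk : 𝟙 (mk Γ hΓ) = homMk hΓ hΓ (Sub.id S n) (isMor_id hΓ) := rfl

theorem homMk_congr {s t : Sub S n m} {hs : T.IsMor Δ Γ s} (h : s = t) :
    homMk hΔ hΓ s hs = homMk hΔ hΓ t (h ▸ hs) := by
  subst h; rfl

end

theorem homMk_proj {m n : ℕ} {Δ : Ctx S m} {Γ : Ctx S n} {A : Ty S n} {hΔ : T.WF Δ}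
    {h : T.WF (Γ.snoc A)} {s : Sub S (n + 1) m} (hs : T.IsMor Δ (Γ.snoc A) s) :
    homMk hΔ h s hs ≫ proj Γ A h = homMk hΔ h.1 s.tail hs.1 :=
  rfl

theorem wf_snoc_subst {m n : ℕ} {Δ : Ctx S m} {Γ : Ctx S n} {A : Ty S n} (hΔ : T.WF Δ)
    (h : T.WF (Γ.snoc A)) {t : Sub S n m} (ht : T.IsMor Δ Γ t) : T.WF (Δ.snoc (A.subst t)) :=
  ⟨hΔ, subst_mor hΔ ht h.2⟩

end ClassifyingCategory

end TypeTheory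

/-- A commutative square is a pullback if it has the existence and uniqueness property with
respect to all cones. -/
theorem isPullback_of_existence_uniqueness {C : Type u} [Category.{v} C] {P X Y Z : C}
    {g : P ⟶ X} {q : P ⟶ Y} {p : X ⟶ Z} {f : Y ⟶ Z} (w : g ≫ p = q ≫ f)
    (ex : ∀ {W : C} (a : W ⟶ X) (b : W ⟶ Y), a ≫ p = b ≫ f → ∃ l : W ⟶ P, l ≫ g = a ∧ l ≫ q = b)
    (uniq : ∀ {W : C} (l l' : W ⟶ P), l ≫ g = l' ≫ g → l ≫ q = l' ≫ q → l = l') :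
    IsPullback g q p f := by
  choose L h1 h2 using @ex
  exact ⟨⟨w⟩, ⟨PullbackCone.IsLimit.mk w (fun s => L s.fst s.snd s.condition)
    (fun s => h1 _ _ _) (fun s => h2 _ _ _)
    (fun s l hl hl' => uniq _ _ (hl.trans (h1 _ _ _).symm) (hl'.trans (h2 _ _ _).symm))⟩⟩

/-! ### Pullbacks of display maps -/

namespace TypeTheory.ClassifyingCategory

variable {S : Signature.{u}} {T : TypeTheory S}

/-- Substitution in types gives pullbacks of display maps. -/
theorem isPullback_proj {m n : ℕ} {Δ : Ctx S m} {Γ : Ctx S n} {A : Ty S n} {hΔ : T.WF Δ}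
    (h : T.WF (Γ.snoc A)) {t : Sub S n m} (ht : T.IsMor Δ Γ t) :
    IsPullback
      (homMk (wf_snoc_subst hΔ h ht) h t.lift (IsMor.lift hΔ ht h.2))
      (proj Δ (A.subst t) (wf_snoc_subst hΔ h ht)) (proj Γ A h) (homMk hΔ h.1 t ht) := by
  apply isPullback_of_existence_uniqueness
  · rw [homMk_proj, proj, homMk_comp]
    exact homMk_congr (Sub.tail_lift t)
  · intro W a b hab
    obtain ⟨l, Θ, hΘ, rfl⟩ := exists_eq_mk W
    obtain ⟨a, ha, rfl⟩ := exists_eq_homMk a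
    obtain ⟨b, hb, rfl⟩ := exists_eq_homMk b
    rw [homMk_proj, homMk_comp, homMk_eq_iff] at hab
    -- The last term of `a` lives over `a.tail`, which agrees with `t` after `b` only up to
    -- derivable equality, so its type has to be converted.
    have ha0 : T.Derivable Θ (.hasType (a 0) ((A.subst t).subst b)) := by
      rw [Expr.subst_subst]
      exact T.conv_hasType ha.2 (MorEq.subst_type hΘ ha.1 hab h.2)
    refine ⟨homMk hΘ _ (b.cons (a 0)) (IsMor.cons hb ha0), ?_, rfl⟩
    rw [homMk_comp, homMk_eq_iff, Sub.lift_comp_cons]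
    refine MorEq.symm hΘ h ha ⟨hab, T.term_refl ha.2⟩
  · intro W a b hab hab'
    obtain ⟨l, Θ, hΘ, rfl⟩ := exists_eq_mk W
    obtain ⟨a, ha, rfl⟩ := exists_eq_homMk a
    obtain ⟨b, hb, rfl⟩ := exists_eq_homMk b
    rw [homMk_proj, homMk_proj, homMk_eq_iff] at hab'
    rw [homMk_comp, homMk_comp, homMk_eq_iff] at hab
    rw [homMk_eq_iff]
    refine ⟨hab', ?_⟩
    have := hab.2
    rw [Expr.subst_subst]
    have e : (t.lift.comp a).tail = t.comp a.tail := by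
      rw [← Sub.wk_comp, ← Sub.comp_assoc, Sub.wk_comp, Sub.tail_lift, Sub.comp_assoc, Sub.wk_comp]
    rw [e] at this
    exact this

/-! ### Contexts and sum types -/

section Sums

variable (P : StrongSums T)

/-- The inverse substitutes `*`. One composite is the identity already as a sequence of terms; the
other is the eta rule for `1`. This is how identity maps become display maps up to isomorphism. -/
theorem isIso_proj_unit {n : ℕ} {Γ : Ctx S n} (h : T.WF (Γ.snoc P.unit)) :
    IsIso (proj Γ P.unit h) := by
  have hs : T.Derivable Γ (.hasType P.star P.unit) := P.star_intro h.1
  refine ⟨homMk h.1 h (Sub.inst P.star) (isMor_inst hs), ?_, rfl⟩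
  rw [proj, homMk_comp, id_eq_homMk, homMk_eq_iff]
  refine MorEq.symm h h (isMor_id h) ⟨MorEq.refl (isMor_wk h), ?_⟩
  have e := P.unit_eta (a := .var 0) (Γ := Γ.snoc P.unit)
    (by simpa only [P.unit_subst] using T.var_rule h.2)
  change T.Derivable _ (.eqTerm (.var 0) (Expr.subst P.star _) (Expr.subst P.unit _))
  rw [P.unit_subst, P.star_subst]
  exact e

/-- The terms `(γ, p x y)` over `[γ ∈ Γ, x ∈ A, y ∈ B]`. -/
def pairSub {n : ℕ} (A : Ty S n) (B : Ty S (n + 1)) : Sub S (n + 1) (n + 2) :=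
  -- `(Sub.wk S (n + 1)).tail` is weakening by two variables, written in the form in which tails of
  -- context morphisms arise.
  (Sub.wk S (n + 1)).tail.cons
    (P.pair (A.subst (Sub.wk S (n + 1)).tail) (B.subst (Sub.wk S (n + 1)).tail.lift)
      (.var 1) (.var 0))

/-- The terms `(γ, p₀ c, p₁ c)` over `[γ ∈ Γ, c ∈ Σ x ∈ A. B]`. -/
def unpairSub {n : ℕ} (A : Ty S n) (B : Ty S (n + 1)) : Sub S (n + 2) (n + 1) :=
  ((Sub.wk S n).cons (P.fst (A.subst (Sub.wk S n)) (B.subst (Sub.wk S n).lift) (.var 0))).cons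
    (P.snd (A.subst (Sub.wk S n)) (B.subst (Sub.wk S n).lift) (.var 0))

section

variable {n : ℕ} {Γ : Ctx S n} {A : Ty S n} {B : Ty S (n + 1)}

theorem wf_sigma (h : T.WF ((Γ.snoc A).snoc B)) : T.WF (Γ.snoc (P.sigma A B)) :=
  ⟨h.1.1, P.sigma_form h.1.2 h.2⟩

theorem var_one_hasType (h : T.WF ((Γ.snoc A).snoc B)) :
    T.Derivable ((Γ.snoc A).snoc B) (.hasType (.var 1) (A.subst (Sub.wk S (n + 1)).tail)) := by
  have := weaken (T.var_rule h.1.2) h.2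
  simp only [Judgement.subst, Expr.subst_subst, Sub.wk_comp] at this
  exact this

/-- Pairing expects its second component in `B`, weakened under its binder and then instantiated at
the variable `x`. That instance is just `B` weakened once. -/
theorem var_zero_hasType (h : T.WF ((Γ.snoc A).snoc B)) :
    T.Derivable ((Γ.snoc A).snoc B)
      (.hasType (.var 0) ((B.subst (Sub.wk S (n + 1)).tail.lift).subst (Sub.inst (.var 1)))) := by
  have := T.var_rule h.2
  rw [Expr.subst_subst, Sub.lift_comp_inst]
  rwa [← Sub.cons_tail (Sub.wk S (n + 1))] at this

theorem isMor_wk_tail (h : T.WF ((Γ.snoc A).snoc B)) :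
    T.IsMor ((Γ.snoc A).snoc B) Γ (Sub.wk S (n + 1)).tail :=
  (isMor_wk h).1

theorem isMor_pairSub (h : T.WF ((Γ.snoc A).snoc B)) :
    T.IsMor ((Γ.snoc A).snoc B) (Γ.snoc (P.sigma A B)) (pairSub P A B) := by
  refine IsMor.cons (isMor_wk_tail h) ?_
  rw [P.sigma_subst]
  exact P.pair_intro (subst_mor (wf_snoc_subst h h.1 (isMor_wk_tail h))
    (IsMor.lift h (isMor_wk_tail h) h.1.2) h.2) (var_one_hasType h) (var_zero_hasType h)

theorem isMor_unpairSub (h : T.WF ((Γ.snoc A).snoc B)) :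
    T.IsMor (Γ.snoc (P.sigma A B)) ((Γ.snoc A).snoc B) (unpairSub P A B) := by
  have hw := wf_sigma P h
  have hB : T.Derivable _ (.isType (B.subst (Sub.wk S n).lift)) :=
    subst_mor (wf_snoc_subst hw h.1 (isMor_wk hw)) (IsMor.lift hw (isMor_wk hw) h.1.2) h.2
  have hc := T.var_rule hw.2
  rw [P.sigma_subst] at hc
  refine IsMor.cons (IsMor.cons (isMor_wk hw) (P.fst_elim hB hc)) ?_
  rw [← Sub.lift_comp_inst, ← Expr.subst_subst]
  exact P.snd_elim hB hc

/-- The isomorphism `[Γ, x ∈ A, y ∈ B] ≅ [Γ, z ∈ Σ x ∈ A. B]`. -/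
def sigmaIso (h : T.WF ((Γ.snoc A).snoc B)) :
    mk ((Γ.snoc A).snoc B) h ≅ mk (Γ.snoc (P.sigma A B)) (wf_sigma P h) where
  hom := homMk h (wf_sigma P h) (pairSub P A B) (isMor_pairSub P h)
  inv := homMk (wf_sigma P h) h (unpairSub P A B) (isMor_unpairSub P h)
  hom_inv_id := by
    have hB : T.Derivable _ (.isType (B.subst (Sub.wk S (n + 1)).tail.lift)) :=
      subst_mor (wf_snoc_subst h h.1 (isMor_wk_tail h)) (IsMor.lift h (isMor_wk_tail h) h.1.2) h.2
    rw [homMk_comp, id_eq_homMk, homMk_eq_iff]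
    have e : (unpairSub P A B).comp (pairSub P A B) =
        ((Sub.wk S (n + 1)).tail.cons (P.fst (A.subst (Sub.wk S (n + 1)).tail)
          (B.subst (Sub.wk S (n + 1)).tail.lift) (pairSub P A B 0))).cons
            (P.snd (A.subst (Sub.wk S (n + 1)).tail)
          (B.subst (Sub.wk S (n + 1)).tail.lift) (pairSub P A B 0)) := by
      simp only [unpairSub, Sub.cons_comp, P.fst_subst, P.snd_subst, Expr.subst_subst,
        Sub.lift_comp, Sub.wk_comp]
      rfl
    rw [e]
    -- `MorEq` types its equations over the left-hand sequence. With the identity on the left no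
    -- projections occur in these types, and the two computation rules for `Σ` apply, reversed.
    refine MorEq.symm h h (isMor_id h) ?_
    have e1 := T.term_symm (P.fst_pair hB (var_one_hasType h) (var_zero_hasType h))
    have e2 := T.term_symm (P.snd_pair hB (var_one_hasType h) (var_zero_hasType h))
    refine ⟨⟨MorEq.refl (isMor_wk_tail h), e1⟩, ?_⟩
    rw [Expr.subst_subst, Sub.lift_comp_inst,
      show (Sub.wk S (n + 1)).tail.cons (.var 1) = Sub.wk S (n + 1) from Sub.cons_tail _] at e2
    exact e2
  inv_hom_id := by
    have hw := wf_sigma P h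
    have hB : T.Derivable _ (.isType (B.subst (Sub.wk S n).lift)) :=
      subst_mor (wf_snoc_subst hw h.1 (isMor_wk hw)) (IsMor.lift hw (isMor_wk hw) h.1.2) h.2
    have hc := T.var_rule hw.2
    rw [P.sigma_subst] at hc
    rw [homMk_comp, id_eq_homMk, homMk_eq_iff]
    have e : (pairSub P A B).comp (unpairSub P A B) =
        (Sub.wk S n).cons (P.pair (A.subst (Sub.wk S n)) (B.subst (Sub.wk S n).lift)
          (unpairSub P A B 1) (unpairSub P A B 0)) := by
      have e' : (Sub.wk S (n + 1)).tail.comp (unpairSub P A B) = Sub.wk S n := rfl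
      simp only [pairSub, Sub.cons_comp, P.pair_subst, Expr.subst_subst, Sub.lift_comp, e']
      rfl
    rw [e]
    refine ⟨MorEq.refl (isMor_wk hw), ?_⟩
    rw [Sub.tail_cons, P.sigma_subst]
    exact P.pair_eta hB hc

/-- The isomorphism lies over `Γ`, so a composite of two display maps is, up to isomorphism, one
display map. -/
theorem sigmaIso_hom_proj (h : T.WF ((Γ.snoc A).snoc B)) :
    (sigmaIso P h).hom ≫ proj Γ (P.sigma A B) (wf_sigma P h) =
      proj (Γ.snoc A) B h ≫ proj Γ A h.1 :=
  rfl

/-- Isomorphic contexts have isomorphic extensions. -/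
theorem exists_iso_snoc {m : ℕ} {Δ : Ctx S m} {hΔ : T.WF Δ} (h : T.WF (Γ.snoc A))
    (e : mk Γ h.1 ≅ mk Δ hΔ) :
    ∃ (A' : Ty S m) (h' : T.WF (Δ.snoc A')) (i : mk (Γ.snoc A) h ≅ mk (Δ.snoc A') h'),
      i.hom ≫ proj Δ A' h' = proj Γ A h ≫ e.hom := by
  obtain ⟨t, ht, he⟩ := exists_eq_homMk e.inv
  -- `A` is pulled back along the inverse `Δ → Γ`. The map between the extensions is then a pullback
  -- of an isomorphism, hence invertible.
  have hp := isPullback_proj (hΔ := hΔ) h ht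
  rw [← he] at hp
  have := hp.isIso_fst_of_isIso
  refine ⟨A.subst t, wf_snoc_subst hΔ h ht, (@asIso _ _ _ _ _ this).symm, ?_⟩
  rw [Iso.symm_hom, asIso_inv, IsIso.inv_comp_eq, ← Category.assoc, hp.w, Category.assoc,
    e.inv_hom_id, Category.comp_id]

end

/-- Every context is isomorphic to one of the form `[x ∈ A]`. -/
theorem exists_mk_iso_typeObj (P : StrongSums T) {n : ℕ} {Γ : Ctx S n} (hΓ : T.WF Γ) :
    ∃ (A : Ty S 0) (hA : T.Derivable .nil (.isType A)),
      Nonempty (mk Γ hΓ ≅ PropositionalIdTypes.typeObj hA) := by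
  induction Γ with
  | nil =>
    have h : T.WF (Ctx.nil.snoc P.unit) := ⟨trivial, P.unit_form trivial⟩
    have := isIso_proj_unit P h
    exact ⟨P.unit, h.2, ⟨(asIso (proj .nil P.unit h)).symm⟩⟩
  | snoc Γ B ih =>
    -- `Γ` is coded by a closed type `A`; the last type is moved along this coding to a type over
    -- `[x ∈ A]` and then absorbed by `Σ`.
    obtain ⟨A, hA, ⟨e⟩⟩ := ih hΓ.1
    obtain ⟨B', h', i, -⟩ := exists_iso_snoc hΓ e
    exact ⟨P.sigma A B', (wf_sigma P h').2, ⟨i ≪≫ sigmaIso P h'⟩⟩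

theorem exists_iso_typeObj (P : StrongSums T) (X : T.ClassifyingCategory) :
    ∃ (A : Ty S 0) (hA : T.Derivable .nil (.isType A)),
      Nonempty (X ≅ PropositionalIdTypes.typeObj hA) := by
  obtain ⟨n, Γ, hΓ, rfl⟩ := exists_eq_mk X
  exact exists_mk_iso_typeObj P hΓ

/-! ### Fibrations -/

theorem displayMaps.exists_iso {X Y : T.ClassifyingCategory} {p : X ⟶ Y} (hp : T.displayMaps p)
    {n : ℕ} {Γ : Ctx S n} {hΓ : T.WF Γ} (e : Y ≅ mk Γ hΓ) :
    ∃ (A : Ty S n) (h : T.WF (Γ.snoc A)) (i : X ≅ mk (Γ.snoc A) h),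
      i.hom ≫ proj Γ A h = p ≫ e.hom := by
  cases hp with
  | proj Γ' A' h' => exact exists_iso_snoc h' e

/-- An identity becomes the display map of `1`, a composite that of a sum type. The codomain is
allowed to vary along an isomorphism `e` because, in a composite, the intermediate object is
identified with a context extension only up to isomorphism; the induction hypothesis is used at that
isomorphism. -/
theorem dependentProjections.exists_iso (P : StrongSums T) {X Y : T.ClassifyingCategory} {p : X ⟶ Y}
    (hp : T.dependentProjections p) :
    ∀ {n : ℕ} {Γ : Ctx S n} {hΓ : T.WF Γ} (e : Y ≅ mk Γ hΓ),
    ∃ (A : Ty S n) (h : T.WF (Γ.snoc A)) (i : X ≅ mk (Γ.snoc A) h),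
      i.hom ≫ proj Γ A h = p ≫ e.hom := by
  induction hp with
  | of f hf => exact fun e => displayMaps.exists_iso hf e
  | id X =>
    intro n Γ hΓ e
    have h : T.WF (Γ.snoc P.unit) := ⟨hΓ, P.unit_form hΓ⟩
    have := isIso_proj_unit P h
    exact ⟨P.unit, h, e ≪≫ (asIso (proj Γ P.unit h)).symm, by simp⟩
  | comp_of f g _ hg ih =>
    intro n Γ hΓ e
    obtain ⟨A, h, i, hi⟩ := displayMaps.exists_iso hg e
    obtain ⟨B, h', j, hj⟩ := ih i
    refine ⟨P.sigma A B, wf_sigma P h', j ≪≫ sigmaIso P h', ?_⟩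
    rw [Iso.trans_hom, Category.assoc, sigmaIso_hom_proj, ← Category.assoc, hj, Category.assoc,
      hi, Category.assoc]

/-- Every fibration is isomorphic to a display map. -/
theorem fibrations.exists_iso (P : StrongSums T) {X : T.ClassifyingCategory} {n : ℕ}
    {Γ : Ctx S n} {hΓ : T.WF Γ} {p : X ⟶ mk Γ hΓ} (hp : T.fibrations p) :
    ∃ (A : Ty S n) (h : T.WF (Γ.snoc A)) (i : X ≅ mk (Γ.snoc A) h),
      i.hom ≫ proj Γ A h = p := by
  obtain ⟨X', Y', p', hp', ⟨e⟩⟩ := hp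
  obtain ⟨a, b, hab⟩ : ∃ (a : X' ≅ X) (b : Y' ≅ mk Γ hΓ), a.hom ≫ p = p' ≫ b.hom :=
    ⟨Arrow.leftFunc.mapIso e, Arrow.rightFunc.mapIso e, Arrow.w e.hom⟩
  obtain ⟨A, h, i, hi⟩ := dependentProjections.exists_iso P hp' b
  refine ⟨A, h, a.symm ≪≫ i, ?_⟩
  rw [Iso.trans_hom, Category.assoc, hi, Iso.symm_hom, Iso.inv_comp_eq, hab]

end Sums

theorem fibrations_of_dependentProjections {X Y : T.ClassifyingCategory} {p : X ⟶ Y}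
    (hp : T.dependentProjections p) : T.fibrations p :=
  MorphismProperty.le_isoClosure _ _ hp

instance : T.fibrations.RespectsIso := MorphismProperty.isoClosure_respectsIso _

theorem fibrations_of_isIso {X Y : T.ClassifyingCategory} (f : X ⟶ Y) [IsIso f] :
    T.fibrations f := by
  have : T.fibrations (f ≫ 𝟙 Y) :=
    MorphismProperty.RespectsIso.precomp _ f _ (fibrations_of_dependentProjections (.id Y))
  rwa [Category.comp_id] at this

theorem fibrations_proj {n : ℕ} {Γ : Ctx S n} {A : Ty S n} (h : T.WF (Γ.snoc A)) :
    T.fibrations (proj Γ A h) :=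
  fibrations_of_dependentProjections (.of _ (.proj Γ A h))

/-- Between two maps that are only isomorphic to dependent projections stands an isomorphism.
Replacing `g` by a display map pushes the isomorphism into `f`, which is then itself replaced by a
display map over the same context, so that the two compose directly. -/
theorem fibrations_comp (P : StrongSums T) {X Y Z : T.ClassifyingCategory} (f : X ⟶ Y) (g : Y ⟶ Z)
    (hf : T.fibrations f) (hg : T.fibrations g) : T.fibrations (f ≫ g) := by
  obtain ⟨n, Γ, hΓ, rfl⟩ := exists_eq_mk Z
  obtain ⟨A, h, i, rfl⟩ := fibrations.exists_iso P hg
  obtain ⟨B, h', j, hj⟩ := fibrations.exists_iso P (p := f ≫ i.hom)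
    (MorphismProperty.RespectsIso.postcomp _ _ _ hf)
  rw [← Category.assoc, ← hj, Category.assoc]
  refine MorphismProperty.RespectsIso.precomp _ j.hom _ (fibrations_of_dependentProjections ?_)
  exact .comp_of _ _ (.of _ (.proj _ _ _)) (.proj _ _ _)

/-- The pullback of a fibration along any map, as a display map. -/
theorem exists_isPullback_of_fibrations (P : StrongSums T) {m n : ℕ} {Δ : Ctx S m} {Γ : Ctx S n}
    {hΔ : T.WF Δ} {hΓ : T.WF Γ} {X : T.ClassifyingCategory} (p : X ⟶ mk Γ hΓ) (hp : T.fibrations p)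
    (f : mk Δ hΔ ⟶ mk Γ hΓ) :
    ∃ (A : Ty S m) (h : T.WF (Δ.snoc A)) (g : mk (Δ.snoc A) h ⟶ X),
      IsPullback g (proj Δ A h) p f := by
  obtain ⟨A, h, i, rfl⟩ := fibrations.exists_iso P hp
  obtain ⟨t, ht, rfl⟩ := exists_eq_homMk f
  refine ⟨A.subst t, wf_snoc_subst hΔ h ht, homMk _ h t.lift (IsMor.lift hΔ ht h.2) ≫ i.inv,
    (isPullback_proj h ht).of_iso (Iso.refl _) i.symm (Iso.refl _) (Iso.refl _)
      ?_ ?_ ?_ ?_⟩ <;> simp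

theorem hasPullback_of_fibrations (P : StrongSums T) {X Y Z : T.ClassifyingCategory} (p : X ⟶ Z)
    (f : Y ⟶ Z) (hp : T.fibrations p) : HasPullback p f := by
  obtain ⟨n, Γ, hΓ, rfl⟩ := exists_eq_mk Z
  obtain ⟨m, Δ, hΔ, rfl⟩ := exists_eq_mk Y
  obtain ⟨A, h, g, hg⟩ := exists_isPullback_of_fibrations P p hp f
  exact hg.hasPullback

/-- Pullbacks are unique up to isomorphism, so any pullback of `p` may be compared with the one that
is a display map. -/
theorem fibrations_of_isPullback (P : StrongSums T) {W X Y Z : T.ClassifyingCategory} {g : W ⟶ X}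
    {q : W ⟶ Y} {p : X ⟶ Z} {f : Y ⟶ Z} (sq : IsPullback g q p f) (hp : T.fibrations p) :
    T.fibrations q := by
  obtain ⟨n, Γ, hΓ, rfl⟩ := exists_eq_mk Z
  obtain ⟨m, Δ, hΔ, rfl⟩ := exists_eq_mk Y
  obtain ⟨A, h, g', hg⟩ := exists_isPullback_of_fibrations P p hp f
  rw [← sq.isoIsPullback_hom_snd _ _ hg]
  exact MorphismProperty.RespectsIso.precomp _ _ _ (fibrations_proj h)

/-- The empty context is terminal. -/
noncomputable def isTerminalNil : IsTerminal (mk (T := T) .nil trivial) := by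
  have hs : ∀ X : T.ClassifyingCategory, Subsingleton (X ⟶ mk (T := T) .nil trivial) := by
    intro X
    obtain ⟨m, Δ, hΔ, rfl⟩ := exists_eq_mk X
    refine ⟨fun a b => ?_⟩
    obtain ⟨a, ha, rfl⟩ := exists_eq_homMk a
    obtain ⟨b, hb, rfl⟩ := exists_eq_homMk b
    exact homMk_eq_iff.2 trivial
  have hn : ∀ X : T.ClassifyingCategory, Nonempty (X ⟶ mk (T := T) .nil trivial) := by
    intro X
    obtain ⟨m, Δ, hΔ, rfl⟩ := exists_eq_mk X
    exact ⟨homMk (Γ := .nil) hΔ trivial (Sub.empty S m) trivial⟩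
  exact IsTerminal.ofUniqueHom (fun X => (hn X).some) (fun X f => (hs X).elim _ _)

theorem fibrations_to_nil (P : StrongSums T) {n : ℕ} {Γ : Ctx S n} (hΓ : T.WF Γ) :
    T.fibrations (isTerminalNil.from (mk Γ hΓ)) := by
  induction Γ with
  | nil =>
    rw [isTerminalNil.hom_ext (isTerminalNil.from _) (𝟙 _)]
    exact fibrations_of_isIso _
  | snoc Γ A ih =>
    rw [isTerminalNil.hom_ext (isTerminalNil.from _) (proj Γ A hΓ ≫ isTerminalNil.from _)]
    exact fibrations_comp P _ _ (fibrations_proj hΓ) (ih hΓ.1)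

theorem fibrations_to_terminal (P : StrongSums T) {X Z : T.ClassifyingCategory} (f : X ⟶ Z)
    (hZ : IsTerminal Z) : T.fibrations f := by
  obtain ⟨n, Γ, hΓ, rfl⟩ := exists_eq_mk X
  rw [hZ.hom_ext f (isTerminalNil.from (mk Γ hΓ) ≫ (isTerminalNil.uniqueUpToIso hZ).hom)]
  exact MorphismProperty.RespectsIso.postcomp _ _ _ (fibrations_to_nil P hΓ)

end TypeTheory.ClassifyingCategory

/-! ### Inhabited types -/

namespace TypeTheory

variable {S : Signature.{u}} {T : TypeTheory S}

variable (T) in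
/-- The type `A` has an element in context `Γ`. -/
def HasElement {n : ℕ} (Γ : Ctx S n) (A : Ty S n) : Prop := ∃ a, T.Derivable Γ (.hasType a A)

theorem HasElement.conv {n : ℕ} {Γ : Ctx S n} {A B : Ty S n} (h : T.HasElement Γ A)
    (e : T.Derivable Γ (.eqType A B)) : T.HasElement Γ B :=
  h.imp fun _ ha => T.conv_hasType ha e

theorem HasElement.subst {m n : ℕ} {Δ : Ctx S m} {Γ : Ctx S n} (hΔ : T.WF Δ) {t : Sub S n m}
    (ht : T.IsMor Δ Γ t) {A : Ty S n} (h : T.HasElement Γ A) : T.HasElement Δ (A.subst t) :=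
  h.elim fun a ha => ⟨a.subst t, subst_mor hΔ ht ha⟩

end TypeTheory

namespace PropositionalIdTypes

open TypeTheory TypeTheory.ClassifyingCategory

variable {S : Signature.{u}} {T : TypeTheory S} (I : PropositionalIdTypes T)

/-! ### Transport -/

section Contexts

variable {n : ℕ} {Γ : Ctx S n} {A : Ty S n}

/-- The projection `(γ, x, y, u) ↦ (γ, x)`. -/
theorem isMor_idCtx_fst (hA : T.Derivable Γ (.isType A)) :
    T.IsMor (idCtx I.Id Γ A) (Γ.snoc A) (Sub.wk S (n + 2)).tail :=
  (isMor_wk (I.wf_idCtx hA)).1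

/-- The projection `(γ, x, y, u) ↦ (γ, y)`. -/
theorem isMor_idCtx_snd (hA : T.Derivable Γ (.isType A)) :
    T.IsMor (idCtx I.Id Γ A) (Γ.snoc A) ((Sub.wk S n).lift.comp (Sub.wk S (n + 2))) := by
  have hw : T.WF (Γ.snoc A) := ⟨wf_of_derivable hA, hA⟩
  exact IsMor.comp (I.wf_idCtx hA) (IsMor.lift hw (isMor_wk hw) hA) (isMor_wk (I.wf_idCtx hA))

/-- Both endpoints of a reflexivity path are the given point. This makes the diagonal case of
transport an identity function, and gives the factorisation of the diagonal through the path object.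
-/
theorem idCtx_snd_comp_idDiag :
    ((Sub.wk S n).lift.comp (Sub.wk S (n + 2))).comp (idDiag I.r A) = Sub.id S (n + 1) := by
  rw [Sub.comp_assoc, Sub.wk_comp, idDiag, Sub.tail_cons, Sub.lift_comp_cons, Sub.wk_comp,
    Sub.tail_cons]
  exact Sub.cons_tail (Sub.id S (n + 1))

theorem idCtx_fst_comp_idDiag :
    (Sub.wk S (n + 2)).tail.comp (idDiag I.r A) = Sub.id S (n + 1) :=
  Sub.cons_tail (Sub.id S (n + 1))

theorem idCtx_fst_comp_idInst (a b p : Tm S n) :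
    (Sub.wk S (n + 2)).tail.comp (idInst a b p) = Sub.inst a := rfl

theorem idCtx_snd_comp_idInst (a b p : Tm S n) :
    ((Sub.wk S n).lift.comp (Sub.wk S (n + 2))).comp (idInst a b p) = Sub.inst b := by
  rw [Sub.comp_assoc, Sub.wk_comp, idInst, Sub.tail_cons, Sub.lift_comp_cons, Sub.wk_comp,
    Sub.tail_cons]
  rfl

/-- Transport along an identification. -/
theorem hasElement_transport {B : Ty S (n + 1)} {a b : Tm S n}
    (hB : T.Derivable (Γ.snoc A) (.isType B)) (ha : T.Derivable Γ (.hasType a A))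
    (hb : T.Derivable Γ (.hasType b A)) (hp : T.HasElement Γ (I.Id A a b))
    (hu : T.HasElement Γ (B.subst (Sub.inst a))) : T.HasElement Γ (B.subst (Sub.inst b)) := by
  obtain ⟨p, hp⟩ := hp
  obtain ⟨v, hv⟩ := hu
  have hA := T.presup_hasType ha
  have hw := I.wf_idCtx hA
  have hx := I.isMor_idCtx_fst hA
  have hy := I.isMor_idCtx_snd hA
  have hBx : T.Derivable (idCtx I.Id Γ A) (.isType (B.subst (Sub.wk S (n + 2)).tail)) :=
    subst_mor hw hx hB
  have hC := weaken (subst_mor hw hy hB) hBx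
  have hd := T.var_rule hB
  -- Function types are not assumed, so `B(x) → B(y)` is not available as a motive. Instead an
  -- element of `B(x)` forms the parameter context and the motive is `B(y)`; on the diagonal the
  -- parameter variable itself is the required element.
  have key := I.J_elim (k := 1) (Γ := Γ) (Ξ := .cons (B.subst (Sub.wk S (n + 2)).tail) .nil)
    (A := A) (C := (B.subst ((Sub.wk S n).lift.comp (Sub.wk S (n + 2)))).subst (Sub.wk S (n + 3)))
    (d := (.var 0 : Tm S (n + 2))) hC ha hb hp (by
      change T.Derivable ((Γ.snoc A).snoc ((B.subst _).subst (idDiag I.r A)))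
        (.hasType (.var 0) (((B.subst _).subst (Sub.wk S (n + 3))).subst (idDiag I.r A).lift))
      rw [Expr.subst_subst, I.idCtx_fst_comp_idDiag, Expr.subst_id, Expr.subst_subst, Sub.wk_comp,
        Sub.tail_lift, Expr.subst_subst, ← Sub.comp_assoc, I.idCtx_snd_comp_idDiag, Sub.id_comp]
      exact hd)
  change T.Derivable (Γ.snoc ((B.subst _).subst (idInst a b p))) (.hasType _
    (((B.subst _).subst (Sub.wk S (n + 3))).subst (idInst a b p).lift)) at key
  rw [Expr.subst_subst, idCtx_fst_comp_idInst, Expr.subst_subst, Sub.wk_comp, Sub.tail_lift,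
    Expr.subst_subst, ← Sub.comp_assoc, idCtx_snd_comp_idInst] at key
  -- The parameter is now replaced by the given element of `B(a)`.
  have := subst_inst key hv
  simp only [Judgement.subst, Expr.subst_subst, Sub.comp_assoc, Sub.wk_comp, Sub.tail_inst,
    Sub.comp_id] at this
  exact ⟨_, this⟩

end Contexts

/-! ### Propositional equality of terms -/

/-- `a` and `b` are propositionally equal elements of `A`. -/
def Related {n : ℕ} (Γ : Ctx S n) (A : Ty S n) (a b : Tm S n) : Prop :=
  T.Derivable Γ (.hasType a A) ∧ T.Derivable Γ (.hasType b A) ∧ T.HasElement Γ (I.Id A a b)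

namespace Related

variable {I} {n : ℕ} {Γ : Ctx S n} {A : Ty S n} {a b c : Tm S n}

theorem of_eqTerm (h : T.Derivable Γ (.eqTerm a b A)) : I.Related Γ A a b := by
  have ha := T.presup_eqTerm h
  exact ⟨ha, presup_eqTerm_right h, _, T.conv_hasType (I.r_intro ha)
    (I.Id_congr (T.type_refl (T.presup_hasType ha)) (T.term_refl ha) h)⟩

/-- If `B(a)` is inhabited, so is `B(b)`. -/
theorem transport (h : I.Related Γ A a b) {B : Ty S (n + 1)}
    (hB : T.Derivable (Γ.snoc A) (.isType B)) (hu : T.HasElement Γ (B.subst (Sub.inst a))) :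
    T.HasElement Γ (B.subst (Sub.inst b)) :=
  I.hasElement_transport hB h.1 h.2.1 h.2.2 hu

/-- Functions preserve propositional equality. -/
theorem map (h : I.Related Γ A a b) {B : Ty S n} {t : Tm S (n + 1)}
    (ht : T.Derivable (Γ.snoc A) (.hasType t (B.subst (Sub.wk S n)))) :
    I.Related Γ B (t.subst (Sub.inst a)) (t.subst (Sub.inst b)) := by
  have key : ∀ {x : Tm S n}, T.Derivable Γ (.hasType x A) →
      T.Derivable Γ (.hasType (t.subst (Sub.inst x)) B) := by
    intro x hx
    have := subst_inst ht hx
    simp only [Judgement.subst, Expr.subst_subst, Sub.wk_comp, Sub.tail_inst, Expr.subst_id] at this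
    exact this
  refine ⟨key h.1, key h.2.1, ?_⟩
  -- Transport takes place in the family `x ↦ Id_B(t(a), t(x))`, which reflexivity inhabits at `x =
  -- a`.
  have hC := I.Id_form (weaken (key h.1) (T.presup_hasType h.1)) ht
  have e : ∀ x, (I.Id (B.subst (Sub.wk S n)) ((t.subst (Sub.inst a)).subst (Sub.wk S n)) t).subst
      (Sub.inst x) = I.Id B (t.subst (Sub.inst a)) (t.subst (Sub.inst x)) := by
    intro x
    rw [I.Id_subst, Expr.subst_subst B, Expr.subst_subst (t.subst _), Sub.wk_comp, Sub.tail_inst,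
      Expr.subst_id, Expr.subst_id]
  have := h.transport hC (by rw [e]; exact ⟨_, I.r_intro (key h.1)⟩)
  rwa [e] at this

/-- Transport of `r(a)` in the family `x ↦ Id_A(x, a)`. -/
theorem symm (h : I.Related Γ A a b) : I.Related Γ A b a := by
  refine ⟨h.2.1, h.1, ?_⟩
  have hA := T.presup_hasType h.1
  have hC := I.Id_form (T.var_rule hA) (weaken h.1 hA)
  have e : ∀ x, (I.Id (A.subst (Sub.wk S n)) (.var 0) (a.subst (Sub.wk S n))).subst
      (Sub.inst x) = I.Id A x a := by
    intro x
    simp only [I.Id_subst, Expr.subst_subst, Sub.wk_comp, Sub.tail_inst, Expr.subst_id]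
    rfl
  have := h.transport hC (by rw [e]; exact ⟨_, I.r_intro h.1⟩)
  rwa [e] at this

/-- Transport along the second identification in the family `x ↦ Id_A(a, x)`. -/
theorem trans (h : I.Related Γ A a b) (h' : I.Related Γ A b c) : I.Related Γ A a c := by
  refine ⟨h.1, h'.2.1, ?_⟩
  have hA := T.presup_hasType h.1
  have hC := I.Id_form (weaken h.1 hA) (T.var_rule hA)
  have e : ∀ x, (I.Id (A.subst (Sub.wk S n)) (a.subst (Sub.wk S n)) (.var 0)).subst
      (Sub.inst x) = I.Id A a x := by
    intro x
    simp only [I.Id_subst, Expr.subst_subst, Sub.wk_comp, Sub.tail_inst, Expr.subst_id]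
    rfl
  have := h'.transport hC (by rw [e]; exact h.2.2)
  rwa [e] at this

end Related

/-! ### Homotopies into closed types -/

section PathRel

variable {A : Ty S 0} {hA : T.Derivable .nil (.isType A)}

/-- Two maps into `[x ∈ A]` are joined by a map into `[x ∈ A, y ∈ A, u ∈ Id_A(x, y)]`. -/
def PathRel (hA : T.Derivable .nil (.isType A)) {X : T.ClassifyingCategory}
    (f g : X ⟶ typeObj hA) : Prop :=
  ∃ h : X ⟶ I.pathObj hA, h ≫ I.src hA = f ∧ h ≫ I.tgt hA = g

variable {m : ℕ} {Δ : Ctx S m} {hΔ : T.WF Δ}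

theorem subst_id_vars {w : Sub S 3 m} :
    (I.Id ((A.subst (Sub.wk S 0)).subst (Sub.wk S 1)) (.var 1) (.var 0)).subst w.tail =
      I.Id (A.subst (Sub.empty S m)) (w 2) (w 1) := by
  simp only [I.Id_subst, Expr.subst_subst]
  congr 2
  exact Subsingleton.elim _ _

/-- A map into the path object is a triple of terms whose first two components equal `s` and `t`
only derivably; congruence of `Id` moves the third to the identity type of `s` and `t` themselves.
Homotopies can then be handled as derivations in context `Δ`. -/
theorem pathRel_homMk_iff {s t : Sub S 1 m} {hs : T.IsMor Δ (Ctx.nil.snoc A) s}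
    {ht : T.IsMor Δ (Ctx.nil.snoc A) t} :
    I.PathRel hA (homMk hΔ (wf_nil_snoc hA) s hs) (homMk hΔ (wf_nil_snoc hA) t ht) ↔
      I.Related Δ (A.subst (Sub.empty S m)) (s 0) (t 0) := by
  have hs0 := hs.2
  have ht0 := ht.2
  rw [Subsingleton.elim s.tail (Sub.empty S m)] at hs0
  rw [Subsingleton.elim t.tail (Sub.empty S m)] at ht0
  constructor
  · rintro ⟨h, h1, h2⟩
    obtain ⟨w, hw, rfl⟩ := exists_eq_homMk (hΓ := I.wf_idCtx hA) h
    have h1 : T.MorEq Δ (Ctx.nil.snoc A) (fun _ => w 2) s := homMk_eq_iff.1 h1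
    have h2 : T.MorEq Δ (Ctx.nil.snoc A) (fun _ => w 1) t := homMk_eq_iff.1 h2
    have e1 := h1.2
    have e2 := h2.2
    rw [Subsingleton.elim (Sub.tail _) (Sub.empty S m)] at e1 e2
    have hw0 := hw.2
    rw [I.subst_id_vars] at hw0
    exact ⟨hs0, ht0, _, T.conv_hasType hw0
      (I.Id_congr (T.type_refl (T.presup_hasType hs0)) e1 e2)⟩
  · rintro ⟨-, -, p, hp⟩
    have hw : T.IsMor Δ (idCtx I.Id .nil A) ((s.cons (t 0)).cons p) := by
      refine ⟨⟨hs, ?_⟩, ?_⟩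
      · rw [Expr.subst_subst, Subsingleton.elim ((Sub.wk S 0).comp _) (Sub.empty S m)]
        exact ht0
      · rw [I.subst_id_vars]
        exact hp
    refine ⟨homMk hΔ (I.wf_idCtx hA) _ hw, homMk_eq_iff.2 ?_, homMk_eq_iff.2 ?_⟩
    · change T.MorEq Δ (Ctx.nil.snoc A) (fun _ => s 0) s
      refine ⟨trivial, ?_⟩
      rw [Subsingleton.elim (Sub.tail _) (Sub.empty S m)]
      exact T.term_refl hs0
    · change T.MorEq Δ (Ctx.nil.snoc A) (fun _ => t 0) t
      refine ⟨trivial, ?_⟩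
      rw [Subsingleton.elim (Sub.tail _) (Sub.empty S m)]
      exact T.term_refl ht0

theorem exists_eq_homMk_typeObj (f : ClassifyingCategory.mk Δ hΔ ⟶ typeObj hA) :
    ∃ (t : Sub S 1 m) (ht : T.IsMor Δ (Ctx.nil.snoc A) t),
      f = homMk hΔ (wf_nil_snoc hA) t ht :=
  exists_eq_homMk f

namespace PathRel

variable {I} {X : T.ClassifyingCategory} {f g k : X ⟶ typeObj hA}

theorem refl (f : X ⟶ typeObj hA) : I.PathRel hA f f := by
  obtain ⟨m, Δ, hΔ, rfl⟩ := exists_eq_mk X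
  obtain ⟨f, hf, rfl⟩ := exists_eq_homMk_typeObj f
  refine I.pathRel_homMk_iff.2 (.of_eqTerm (T.term_refl ?_))
  rw [Subsingleton.elim (Sub.empty S m) f.tail]
  exact hf.2

theorem symm (h : I.PathRel hA f g) : I.PathRel hA g f := by
  obtain ⟨m, Δ, hΔ, rfl⟩ := exists_eq_mk X
  obtain ⟨f, hf, rfl⟩ := exists_eq_homMk_typeObj f
  obtain ⟨g, hg, rfl⟩ := exists_eq_homMk_typeObj g
  rw [pathRel_homMk_iff] at h ⊢
  exact h.symm

theorem trans (h : I.PathRel hA f g) (h' : I.PathRel hA g k) : I.PathRel hA f k := by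
  obtain ⟨m, Δ, hΔ, rfl⟩ := exists_eq_mk X
  obtain ⟨f, hf, rfl⟩ := exists_eq_homMk_typeObj f
  obtain ⟨g, hg, rfl⟩ := exists_eq_homMk_typeObj g
  obtain ⟨k, hk, rfl⟩ := exists_eq_homMk_typeObj k
  rw [pathRel_homMk_iff] at h h' ⊢
  exact h.trans h'

theorem precomp {W : T.ClassifyingCategory} (a : W ⟶ X) (h : I.PathRel hA f g) :
    I.PathRel hA (a ≫ f) (a ≫ g) := by
  obtain ⟨h, rfl, rfl⟩ := h
  exact ⟨a ≫ h, Category.assoc _ _ _, Category.assoc _ _ _⟩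

theorem postcomp {B : Ty S 0} {hB : T.Derivable .nil (.isType B)} (h : I.PathRel hA f g)
    (a : typeObj hA ⟶ typeObj hB) : I.PathRel hB (f ≫ a) (g ≫ a) := by
  obtain ⟨m, Δ, hΔ, rfl⟩ := exists_eq_mk X
  obtain ⟨f, hf, rfl⟩ := exists_eq_homMk_typeObj f
  obtain ⟨g, hg, rfl⟩ := exists_eq_homMk_typeObj g
  obtain ⟨a, ha, rfl⟩ := exists_eq_homMk_typeObj (hΔ := wf_nil_snoc hA) a
  rw [pathRel_homMk_iff] at h
  refine I.pathRel_homMk_iff.2 ?_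
  have hl : T.IsMor (Δ.snoc (A.subst (Sub.empty S m))) (Ctx.nil.snoc A) (Sub.empty S m).lift :=
    IsMor.lift (Γ := .nil) hΔ trivial hA
  -- The term representing `a` lives over `[x ∈ A]`; it is moved to the ambient context `Δ` so that
  -- `Related.map` applies.
  have ht : T.Derivable (Δ.snoc (A.subst (Sub.empty S m))) (.hasType
      ((a 0).subst (Sub.empty S m).lift) ((B.subst (Sub.empty S m)).subst (Sub.wk S m))) := by
    have hw : T.WF (Δ.snoc (A.subst (Sub.empty S m))) := ⟨hΔ, T.presup_hasType h.1⟩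
    have := subst_mor hw hl ha.2
    simp only [Judgement.subst, Expr.subst_subst] at this ⊢
    rwa [Subsingleton.elim (a.tail.comp _) ((Sub.empty S m).comp (Sub.wk S m))] at this
  have := h.map ht
  rw [Expr.subst_subst, Expr.subst_subst, Sub.lift_comp_inst, Sub.lift_comp_inst,
    ← Sub.eq_empty_cons, ← Sub.eq_empty_cons] at this
  exact this

end PathRel

end PathRel

end PropositionalIdTypes

/-- The invertible composites give `g` a section and a retraction, so `g` is invertible, and then
`f` and `h` follow by cancellation. -/
theorem isIso_of_two_out_of_six {C : Type u} [Category.{v} C] {W X Y Z : C} (f : W ⟶ X)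
    (g : X ⟶ Y) (h : Y ⟶ Z) (hfg : IsIso (f ≫ g)) (hgh : IsIso (g ≫ h)) :
    IsIso f ∧ IsIso g ∧ IsIso h := by
  have hm : IsSplitMono g := ⟨⟨⟨h ≫ inv (g ≫ h), by rw [← Category.assoc, IsIso.hom_inv_id]⟩⟩⟩
  have he : IsSplitEpi g := ⟨⟨⟨inv (f ≫ g) ≫ f, by rw [Category.assoc, IsIso.inv_hom_id]⟩⟩⟩
  have hg : IsIso g := isIso_of_mono_of_isSplitEpi g
  exact ⟨IsIso.of_isIso_comp_right f g, hg, IsIso.of_isIso_comp_left g h⟩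

namespace PropositionalIdTypes

open TypeTheory TypeTheory.ClassifyingCategory

variable {S : Signature.{u}} {T : TypeTheory S} (I : PropositionalIdTypes T)

/-! ### Homotopy is a congruence -/

namespace Homotopic

variable {I} {X Y : T.ClassifyingCategory} {f g k : X ⟶ Y}

theorem of_pathRel {A : Ty S 0} {hA : T.Derivable .nil (.isType A)} (e : Y ≅ typeObj hA)
    (h : I.PathRel hA (f ≫ e.hom) (g ≫ e.hom)) : I.Homotopic f g :=
  ⟨A, hA, e, h⟩

/-- Homotopy does not depend on the closed type chosen to code `Y`: two codings differ by a map
between closed types, and postcomposition with it preserves the relation. This is what makes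
homotopy transitive. -/
theorem pathRel (h : I.Homotopic f g) {A : Ty S 0} {hA : T.Derivable .nil (.isType A)}
    (e : Y ≅ typeObj hA) : I.PathRel hA (f ≫ e.hom) (g ≫ e.hom) := by
  obtain ⟨B, hB, e', h⟩ := h
  have h : I.PathRel hB (f ≫ e'.hom) (g ≫ e'.hom) := h
  simpa using h.postcomp (e'.inv ≫ e.hom)

/-- Even reflexivity requires some coding of `Y` by a closed type; sums and the unit type supply
one. -/
theorem refl (P : StrongSums T) (f : X ⟶ Y) : I.Homotopic f f := by
  obtain ⟨A, hA, ⟨e⟩⟩ := exists_iso_typeObj P Y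
  exact of_pathRel e (.refl _)

theorem of_eq (P : StrongSums T) (h : f = g) : I.Homotopic f g := h ▸ refl P f

theorem symm (h : I.Homotopic f g) : I.Homotopic g f := by
  obtain ⟨A, hA, e, h⟩ := h
  exact of_pathRel e (PathRel.symm h)

theorem trans (h : I.Homotopic f g) (h' : I.Homotopic g k) : I.Homotopic f k := by
  obtain ⟨A, hA, e, h⟩ := h
  exact of_pathRel e (PathRel.trans h (h'.pathRel e))

theorem precomp {W : T.ClassifyingCategory} (a : W ⟶ X) (h : I.Homotopic f g) :
    I.Homotopic (a ≫ f) (a ≫ g) := by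
  obtain ⟨A, hA, e, h⟩ := h
  refine of_pathRel e ?_
  rw [Category.assoc, Category.assoc]
  exact PathRel.precomp a h

theorem postcomp (P : StrongSums T) {Z : T.ClassifyingCategory} (h : I.Homotopic f g)
    (a : Y ⟶ Z) : I.Homotopic (f ≫ a) (g ≫ a) := by
  obtain ⟨A, hA, e, h⟩ := h
  obtain ⟨B, hB, ⟨e'⟩⟩ := exists_iso_typeObj P Z
  refine of_pathRel e' ?_
  simpa using PathRel.postcomp h (e.inv ≫ a ≫ e'.hom)

end Homotopic

/-- The homotopy relation on the morphisms of the classifying category. -/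
def homotopyRel : HomRel T.ClassifyingCategory := fun _ _ f g => I.Homotopic f g

theorem congruence_homotopyRel (P : StrongSums T) : Congruence I.homotopyRel where
  equivalence := ⟨fun f => .refl P f, fun h => Homotopic.symm h, fun h h' => Homotopic.trans h h'⟩
  comp_left f _ _ h := Homotopic.precomp f h
  comp_right g h := Homotopic.postcomp P h g

/-- The functor from the classifying category to its homotopy category. -/
abbrev toHomotopyCategory : T.ClassifyingCategory ⥤ CategoryTheory.Quotient I.homotopyRel :=
  CategoryTheory.Quotient.functor I.homotopyRel

theorem toHomotopyCategory_map_eq_iff (P : StrongSums T) {X Y : T.ClassifyingCategory}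
    (f g : X ⟶ Y) : I.toHomotopyCategory.map f = I.toHomotopyCategory.map g ↔ I.Homotopic f g := by
  have := I.congruence_homotopyRel P
  exact CategoryTheory.Quotient.functor_map_eq_iff _ f g

/-- A map is a homotopy equivalence if and only if it is invertible in the homotopy category. -/
theorem homotopyEquivalences_iff (P : StrongSums T) {X Y : T.ClassifyingCategory} (f : X ⟶ Y) :
    I.homotopyEquivalences f ↔ IsIso (I.toHomotopyCategory.map f) := by
  constructor
  · rintro ⟨g, h, h'⟩
    refine ⟨I.toHomotopyCategory.map g, ?_, ?_⟩
    · rw [← Functor.map_comp, ← CategoryTheory.Functor.map_id]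
      exact (I.toHomotopyCategory_map_eq_iff P _ _).2 h
    · rw [← Functor.map_comp, ← CategoryTheory.Functor.map_id]
      exact (I.toHomotopyCategory_map_eq_iff P _ _).2 h'
  · intro hf
    obtain ⟨g, hg⟩ := I.toHomotopyCategory.map_surjective (inv (I.toHomotopyCategory.map f))
    refine ⟨g, (I.toHomotopyCategory_map_eq_iff P _ _).1 ?_,
      (I.toHomotopyCategory_map_eq_iff P _ _).1 ?_⟩
    · rw [Functor.map_comp, hg, IsIso.hom_inv_id, CategoryTheory.Functor.map_id]
    · rw [Functor.map_comp, hg, IsIso.inv_hom_id, CategoryTheory.Functor.map_id]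

theorem homotopyEquivalences_of_isIso (P : StrongSums T) {X Y : T.ClassifyingCategory} (f : X ⟶ Y)
    (_ : IsIso f) : I.homotopyEquivalences f :=
  (I.homotopyEquivalences_iff P f).2 inferInstance

theorem homotopyEquivalences_comp (P : StrongSums T) {X Y Z : T.ClassifyingCategory} {f : X ⟶ Y}
    {g : Y ⟶ Z} (hf : I.homotopyEquivalences f) (hg : I.homotopyEquivalences g) :
    I.homotopyEquivalences (f ≫ g) := by
  rw [homotopyEquivalences_iff I P] at hf hg ⊢
  rw [Functor.map_comp]
  infer_instance

theorem homotopyEquivalences_two_out_of_six (P : StrongSums T) {W X Y Z : T.ClassifyingCategory}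
    (f : W ⟶ X) (g : X ⟶ Y) (h : Y ⟶ Z) (hfg : I.homotopyEquivalences (f ≫ g))
    (hgh : I.homotopyEquivalences (g ≫ h)) :
    I.homotopyEquivalences f ∧ I.homotopyEquivalences g ∧ I.homotopyEquivalences h ∧
      I.homotopyEquivalences (f ≫ g ≫ h) := by
  have key : I.homotopyEquivalences f ∧ I.homotopyEquivalences g ∧ I.homotopyEquivalences h := by
    simp only [homotopyEquivalences_iff I P, Functor.map_comp] at hfg hgh ⊢
    exact isIso_of_two_out_of_six _ _ _ hfg hgh
  exact ⟨key.1, key.2.1, key.2.2, I.homotopyEquivalences_comp P key.1 hgh⟩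

/-! ### Acyclic fibrations -/

/-- With `ε` coding `Γ` in a closed type, homotopy of two maps into `Γ` means propositional equality
of their codes. -/
theorem homotopic_homMk_iff {m n : ℕ} {Δ : Ctx S m} {Γ : Ctx S n} {hΔ : T.WF Δ} {hΓ : T.WF Γ}
    {s t : Sub S n m} {hs : T.IsMor Δ Γ s} {ht : T.IsMor Δ Γ t} {A : Ty S 0}
    {hA : T.Derivable .nil (.isType A)} (e : ClassifyingCategory.mk Γ hΓ ≅ typeObj hA)
    {ε : Sub S 1 n} {hε : T.IsMor Γ (Ctx.nil.snoc A) ε}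
    (he : e.hom = homMk hΓ (wf_nil_snoc hA) ε hε) :
    I.Homotopic (homMk hΔ hΓ s hs) (homMk hΔ hΓ t ht) ↔
      I.Related Δ (A.subst (Sub.empty S m)) ((ε 0).subst s) ((ε 0).subst t) := by
  have : I.PathRel hA (homMk hΔ hΓ s hs ≫ e.hom) (homMk hΔ hΓ t ht ≫ e.hom) ↔
      I.Related Δ (A.subst (Sub.empty S m)) ((ε 0).subst s) ((ε 0).subst t) := by
    rw [he]
    exact I.pathRel_homMk_iff (s := ε.comp s) (t := ε.comp t) (hs := IsMor.comp hΔ hε hs)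
      (ht := IsMor.comp hΔ hε ht)
  exact ⟨fun h => this.1 (h.pathRel e), fun h => .of_pathRel e (this.2 h)⟩

/-- Elements of a type can be transported along a homotopy. -/
theorem Homotopic.transport (P : StrongSums T) {I : PropositionalIdTypes T} {m n : ℕ} {Δ : Ctx S m}
    {Γ : Ctx S n} {hΔ : T.WF Δ} {hΓ : T.WF Γ} {s t : Sub S n m} {hs : T.IsMor Δ Γ s}
    {ht : T.IsMor Δ Γ t} (h : I.Homotopic (homMk hΔ hΓ s hs) (homMk hΔ hΓ t ht)) {B : Ty S n}
    (hB : T.Derivable Γ (.isType B)) (hu : T.HasElement Δ (B.subst s)) :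
    T.HasElement Δ (B.subst t) := by
  obtain ⟨A, hA, ⟨e⟩⟩ := exists_iso_typeObj P (ClassifyingCategory.mk Γ hΓ)
  obtain ⟨ε, hε, he⟩ := exists_eq_homMk_typeObj e.hom
  obtain ⟨u, hu', he'⟩ := exists_eq_homMk (hΔ := wf_nil_snoc hA) e.inv
  have hid := e.hom_inv_id
  rw [he, he'] at hid
  have hid : T.MorEq Γ Γ (u.comp ε) (Sub.id S n) := homMk_eq_iff.1 hid
  -- Decoding after coding is derivably the identity, so `B` evaluated at the decoded code of `w` is
  -- `B(w)`.
  have hc : ∀ {w : Sub S n m}, T.IsMor Δ Γ w →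
      T.Derivable Δ (.eqType (B.subst (u.comp (ε.comp w))) (B.subst w)) := by
    intro w hw
    have := MorEq.comp_left hΔ hw hid
    rw [Sub.comp_assoc, Sub.id_comp] at this
    exact MorEq.subst_type hΔ (IsMor.comp hΔ hu' (IsMor.comp hΔ hε hw)) this hB
  have hr := (I.homotopic_homMk_iff e he).1 h
  have hl : T.IsMor (Δ.snoc (A.subst (Sub.empty S m))) (Ctx.nil.snoc A) (Sub.empty S m).lift :=
    IsMor.lift (Γ := .nil) hΔ trivial hA
  have hw : T.WF (Δ.snoc (A.subst (Sub.empty S m))) := ⟨hΔ, T.presup_hasType hr.1⟩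
  -- The family `x ↦ B(u(x))` of decoded points, over the single variable `x ∈ A`, reduces the claim
  -- to transport between the codes of `s` and `t`.
  have hB' : T.Derivable _ (.isType (B.subst (u.comp (Sub.empty S m).lift))) :=
    subst_mor hw (IsMor.comp hw hu' hl) hB
  have he : ∀ w : Sub S n m, (B.subst (u.comp (Sub.empty S m).lift)).subst
      (Sub.inst ((ε 0).subst w)) = B.subst (u.comp (ε.comp w)) := by
    intro w
    rw [Expr.subst_subst, Sub.comp_assoc, Sub.lift_comp_inst, Sub.eq_empty_cons (ε.comp w)]
    rfl
  have := hr.transport hB' (by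
    rw [he]
    exact hu.conv (T.type_symm (hc hs)))
  rw [he] at this
  exact this.conv (hc ht)

/-! ### Contractible types and display maps that are homotopy equivalences -/

section Contractible

variable {n : ℕ} {Γ : Ctx S n} {A : Ty S n}

/-- The type `A` over `Γ` is contractible. -/
def Contractible (Γ : Ctx S n) (A : Ty S n) : Prop :=
  ∃ s, T.Derivable Γ (.hasType s A) ∧
    T.HasElement (Γ.snoc A) (I.Id (A.subst (Sub.wk S n)) (s.subst (Sub.wk S n)) (.var 0))

/-- The centre and the contraction are both derivable terms and can be substituted into. Stability
of acyclic fibrations under pullback comes from here. -/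
theorem Contractible.subst {I : PropositionalIdTypes T} {m : ℕ} {Δ : Ctx S m} {t : Sub S n m}
    (h : I.Contractible Γ A) (hΔ : T.WF Δ) (ht : T.IsMor Δ Γ t) :
    I.Contractible Δ (A.subst t) := by
  obtain ⟨s, hs, hc⟩ := h
  have hA := T.presup_hasType hs
  have hw : T.WF (Γ.snoc A) := ⟨wf_of_derivable hs, hA⟩
  refine ⟨s.subst t, subst_mor hΔ ht hs, ?_⟩
  have := hc.subst (wf_snoc_subst hΔ hw ht) (IsMor.lift hΔ ht hA)
  rw [I.Id_subst, Expr.subst_subst, Expr.subst_subst, Sub.wk_comp, Sub.tail_lift,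
    ← Expr.subst_subst, ← Expr.subst_subst] at this
  exact this

/-- The last term of a homotopy inverse `w` lies in `A(w.tail)`, and `w.tail` is homotopic to the
identity of `Γ`. Transport along this homotopy produces an element of `A` over `Γ`, that is, a
strict section. -/
theorem hasElement_of_homotopyEquivalences_proj (P : StrongSums T) {h : T.WF (Γ.snoc A)}
    (hp : I.homotopyEquivalences (proj Γ A h)) : T.HasElement Γ A := by
  obtain ⟨g, -, hg⟩ := hp
  obtain ⟨w, hw, rfl⟩ := exists_eq_homMk g
  rw [homMk_proj, id_eq_homMk] at hg
  have := hg.transport P h.2 ⟨w 0, hw.2⟩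
  rwa [Expr.subst_id] at this

theorem contractible_of_homotopyEquivalences_proj (P : StrongSums T) {h : T.WF (Γ.snoc A)}
    (hp : I.homotopyEquivalences (proj Γ A h)) : I.Contractible Γ A := by
  obtain ⟨s, hs⟩ := I.hasElement_of_homotopyEquivalences_proj P hp
  refine ⟨s, hs, ?_⟩
  have hp' := (I.homotopyEquivalences_iff P _).1 hp
  have hsec : homMk h.1 h (Sub.inst s) (isMor_inst hs) ≫ proj Γ A h = 𝟙 _ := rfl
  -- The projection is invertible in the homotopy category, so its strict section is a two-sided
  -- inverse there.
  have hh : I.Homotopic (proj Γ A h ≫ homMk h.1 h (Sub.inst s) (isMor_inst hs)) (𝟙 _) := by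
    rw [← I.toHomotopyCategory_map_eq_iff P, ← cancel_mono (I.toHomotopyCategory.map (proj Γ A h)),
      ← Functor.map_comp, ← Functor.map_comp, Category.assoc, hsec, Category.comp_id,
      Category.id_comp]
  rw [proj, homMk_comp, id_eq_homMk] at hh
  have hs' := weaken hs h.2
  -- The family over `(γ, x)` is `Id_A(s(γ), x)`: at the point `(γ, s(γ))` it is inhabited by
  -- reflexivity, and the homotopy carries it to the generic point.
  have := hh.transport P (I.Id_form hs' (T.var_rule h.2)) (by
    rw [I.Id_subst, Expr.subst_subst, Expr.subst_subst]
    exact ⟨_, I.r_intro hs'⟩)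
  rwa [Expr.subst_id] at this

/-- The centre is a strict section. The contraction is a fibrewise homotopy from `s` to the generic
point; applying a coding of `[Γ, x ∈ A]` by a closed type turns it into a homotopy of maps. -/
theorem homotopyEquivalences_proj_of_contractible (P : StrongSums T) (h : T.WF (Γ.snoc A))
    (hc : I.Contractible Γ A) : I.homotopyEquivalences (proj Γ A h) := by
  obtain ⟨s, hs, hc⟩ := hc
  refine ⟨homMk h.1 h (Sub.inst s) (isMor_inst hs), ?_, .refl P _⟩
  rw [proj, homMk_comp, id_eq_homMk]
  obtain ⟨G, hG, ⟨e⟩⟩ := exists_iso_typeObj P (ClassifyingCategory.mk (Γ.snoc A) h)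
  obtain ⟨ε, hε, he⟩ := exists_eq_homMk_typeObj e.hom
  refine (I.homotopic_homMk_iff e he).2 ?_
  have hr : I.Related (Γ.snoc A) (A.subst (Sub.wk S n)) (s.subst (Sub.wk S n)) (.var 0) :=
    ⟨weaken hs h.2, T.var_rule h.2, hc⟩
  have hl := IsMor.lift h (isMor_wk h) h.2
  -- The code as a function of the last variable alone: over the generic `(γ, x)`, a fresh `x'` goes
  -- to the code of `(γ, x')`.
  have ht : T.Derivable ((Γ.snoc A).snoc (A.subst (Sub.wk S n))) (.hasType
      ((ε 0).subst (Sub.wk S n).lift)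
      ((G.subst (Sub.empty S (n + 1))).subst (Sub.wk S (n + 1)))) := by
    have := subst_mor (wf_snoc_subst h h (isMor_wk h)) hl hε.2
    simp only [Judgement.subst, Expr.subst_subst] at this ⊢
    rwa [Subsingleton.elim (ε.tail.comp _) ((Sub.empty S (n + 1)).comp (Sub.wk S (n + 1)))] at this
  have := hr.map ht
  rw [Expr.subst_subst, Expr.subst_subst, Sub.lift_comp_inst, Sub.lift_comp_inst] at this
  rw [Sub.inst_comp]
  rwa [show (Sub.wk S n).cons (.var 0) = Sub.id S (n + 1) from Sub.cons_tail (Sub.id S (n + 1))]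
    at this

end Contractible

/-- The fibre of an acyclic fibration is contractible. -/
theorem exists_iso_of_acyclic (P : StrongSums T) {n : ℕ} {Γ : Ctx S n} {hΓ : T.WF Γ}
    {X : T.ClassifyingCategory} {p : X ⟶ ClassifyingCategory.mk Γ hΓ} (hp : T.fibrations p)
    (hp' : I.homotopyEquivalences p) :
    ∃ (A : Ty S n) (h : T.WF (Γ.snoc A)) (i : X ≅ ClassifyingCategory.mk (Γ.snoc A) h),
      i.hom ≫ proj Γ A h = p ∧ I.Contractible Γ A := by
  obtain ⟨A, h, i, rfl⟩ := fibrations.exists_iso P hp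
  refine ⟨A, h, i, rfl, I.contractible_of_homotopyEquivalences_proj P (h := h) ?_⟩
  have := I.homotopyEquivalences_comp P
    (I.homotopyEquivalences_of_isIso P i.inv inferInstance) hp'
  rwa [Iso.inv_hom_id_assoc] at this

theorem exists_section_of_acyclic (P : StrongSums T) {X Y : T.ClassifyingCategory} (p : X ⟶ Y)
    (hp : T.fibrations p) (hp' : I.homotopyEquivalences p) : ∃ s : Y ⟶ X, s ≫ p = 𝟙 Y := by
  obtain ⟨n, Γ, hΓ, rfl⟩ := exists_eq_mk Y
  obtain ⟨A, h, i, rfl, s, hs, -⟩ := I.exists_iso_of_acyclic P hp hp'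
  refine ⟨homMk hΓ h (Sub.inst s) (isMor_inst hs) ≫ i.inv, ?_⟩
  rw [Category.assoc, Iso.inv_hom_id_assoc]
  rfl

/-- Up to isomorphism the pullback is the display map of a substituted type, which is again
contractible. -/
theorem homotopyEquivalences_of_isPullback (P : StrongSums T) {W X Y Z : T.ClassifyingCategory}
    {g : W ⟶ X} {q : W ⟶ Y} {p : X ⟶ Z} {f : Y ⟶ Z} (sq : IsPullback g q p f)
    (hp : T.fibrations p) (hp' : I.homotopyEquivalences p) : I.homotopyEquivalences q := by
  obtain ⟨n, Γ, hΓ, rfl⟩ := exists_eq_mk Z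
  obtain ⟨m, Δ, hΔ, rfl⟩ := exists_eq_mk Y
  obtain ⟨A, h, i, rfl, hc⟩ := I.exists_iso_of_acyclic P hp hp'
  obtain ⟨t, ht, rfl⟩ := exists_eq_homMk f
  have sq' : IsPullback (g ≫ i.hom) q (proj Γ A h) (homMk hΔ hΓ t ht) := by
    refine sq.of_iso (Iso.refl _) i (Iso.refl _) (Iso.refl _) ?_ ?_ ?_ ?_ <;> simp
  rw [← sq'.isoIsPullback_hom_snd _ _ (isPullback_proj h ht)]
  exact I.homotopyEquivalences_comp P (I.homotopyEquivalences_of_isIso P _ inferInstance)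
    (I.homotopyEquivalences_proj_of_contractible P _ (hc.subst hΔ ht))

/-! ### Path objects -/

section PathObjects

/-- The identity context is stable under substitution. The two equations in the proof exchange
weakening with substitution, since lifting `t` yields types weakened first and substituted
afterwards. -/
theorem isMor_idCtx_lift {m n : ℕ} {Δ : Ctx S m} {Γ : Ctx S n} {A : Ty S n} {t : Sub S n m}
    (hΔ : T.WF Δ) (ht : T.IsMor Δ Γ t) (hA : T.Derivable Γ (.isType A)) :
    T.IsMor (idCtx I.Id Δ (A.subst t)) (idCtx I.Id Γ A) t.lift.lift.lift := by
  have hw := I.wf_idCtx (A := A.subst t) (subst_mor hΔ ht hA)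
  have e : (A.subst (Sub.wk S n)).subst t.lift = (A.subst t).subst (Sub.wk S m) := by
    rw [Expr.subst_subst, Expr.subst_subst, Sub.wk_comp, Sub.tail_lift]
  have e' : ((A.subst (Sub.wk S n)).subst (Sub.wk S (n + 1))).subst t.lift.lift =
      ((A.subst t).subst (Sub.wk S m)).subst (Sub.wk S (m + 1)) := by
    rw [← e, Expr.subst_subst _ (Sub.wk S (n + 1)), Expr.subst_subst _ t.lift, Sub.wk_comp,
      Sub.tail_lift]
  have h2 := IsMor.lift hw.1.1 (IsMor.lift hΔ ht hA) (I.wf_idCtx hA).1.2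
  rw [e] at h2
  have h3 := IsMor.lift hw.1 h2 (I.wf_idCtx hA).2
  rw [I.Id_subst, e'] at h3
  exact h3

theorem lift_comp_idDiag {m n : ℕ} {A : Ty S n} (t : Sub S n m) :
    t.lift.lift.lift.comp (idDiag I.r (A.subst t)) = (idDiag I.r A).comp t.lift := by
  simp only [idDiag, Sub.lift_comp_cons, Sub.cons_comp, I.r_subst, Expr.subst_subst, Sub.wk_comp,
    Sub.tail_lift]
  rfl

theorem isMor_idDiag {n : ℕ} {Γ : Ctx S n} {A : Ty S n} (hA : T.Derivable Γ (.isType A)) :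
    T.IsMor (Γ.snoc A) (idCtx I.Id Γ A) (idDiag I.r A) := by
  have hw : T.WF (Γ.snoc A) := ⟨wf_of_derivable hA, hA⟩
  have hx := T.var_rule hA
  refine ⟨⟨⟨isMor_wk hw, hx⟩, ?_⟩, ?_⟩
  · rw [Expr.subst_subst]
    exact hx
  · rw [I.Id_subst, Expr.subst_subst, Expr.subst_subst]
    exact I.r_intro hx

/-- Path induction without parameters. -/
theorem hasElement_idCtx {n : ℕ} {Γ : Ctx S n} {A : Ty S n} {C : Ty S (n + 3)}
    (hC : T.Derivable (idCtx I.Id Γ A) (.isType C))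
    (hd : T.HasElement (Γ.snoc A) (C.subst (idDiag I.r A))) :
    T.HasElement (idCtx I.Id Γ A) C := by
  obtain ⟨d, hd⟩ := hd
  have hA : T.Derivable Γ (.isType A) := T.presup_ctx (T.presup_ctx (T.presup_ctx hC))
  have hw := I.wf_idCtx hA
  -- `J` eliminates given terms `a, b, p` of the ambient context. To reach the generic triple, the
  -- whole problem is weakened along `t` into the identity context itself, where the variables 2, 1,
  -- 0 serve as `a, b, p`.
  let t : Sub S n (n + 3) := (Sub.wk S (n + 2)).tail.tail
  have ht : T.IsMor (idCtx I.Id Γ A) Γ t := (I.isMor_idCtx_fst hA).1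
  have hA' : T.Derivable (idCtx I.Id Γ A) (.isType (A.subst t)) := subst_mor hw ht hA
  have hC' : T.Derivable _ (.isType (C.subst t.lift.lift.lift)) :=
    subst_mor (I.wf_idCtx hA') (I.isMor_idCtx_lift hw ht hA) hC
  have hd' : T.Derivable _ (.hasType (d.subst t.lift) ((C.subst (idDiag I.r A)).subst t.lift)) :=
    subst_mor (wf_snoc_subst hw hw.1.1 ht) (IsMor.lift hw ht hA) hd
  rw [Expr.subst_subst, ← I.lift_comp_idDiag, ← Expr.subst_subst] at hd'
  have h2 : T.Derivable (idCtx I.Id Γ A) (.hasType (.var 2) (A.subst t)) :=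
    (I.isMor_idCtx_fst hA).2
  have h1 : T.Derivable (idCtx I.Id Γ A) (.hasType (.var 1) (A.subst t)) := by
    have := (I.isMor_idCtx_snd hA).2
    rwa [← Sub.wk_comp, ← Sub.comp_assoc, Sub.wk_comp, Sub.tail_lift] at this
  have h0 : T.Derivable (idCtx I.Id Γ A)
      (.hasType (.var 0) (I.Id (A.subst t) (.var 2) (.var 1))) := by
    have e : (I.Id ((A.subst (Sub.wk S n)).subst (Sub.wk S (n + 1))) (.var 1) (.var 0)).subst
        (Sub.wk S (n + 2)) = I.Id (A.subst t) (.var 2) (.var 1) := by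
      rw [I.Id_subst, Expr.subst_subst, Expr.subst_subst]
      rfl
    rw [← e]
    exact T.var_rule hw.2
  have key := I.J_elim (k := 0) (Γ := idCtx I.Id Γ A) (A := A.subst t) (Ξ := .nil)
    (C := C.subst t.lift.lift.lift) hC' h2 h1 h0 hd'
  change T.Derivable (idCtx I.Id Γ A) (.hasType _
    ((C.subst t.lift.lift.lift).subst (idInst (.var 2) (.var 1) (.var 0)))) at key
  -- Instantiating the weakened motive at the generic triple undoes the weakening.
  have e : t.lift.lift.lift.comp (idInst (.var 2) (.var 1) (.var 0)) = Sub.id S (n + 3) := by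
    simp only [idInst, Sub.lift_comp_cons, Sub.comp_id]
    rw [show t.cons (.var 2) = (Sub.wk S (n + 2)).tail from Sub.cons_tail (Sub.wk S (n + 2)).tail,
      show (Sub.wk S (n + 2)).tail.cons (.var 1) = Sub.wk S (n + 2) from Sub.cons_tail _]
    exact Sub.cons_tail (Sub.id S (n + 3))
  rw [Expr.subst_subst, e, Expr.subst_id] at key
  exact ⟨_, key⟩

variable {A : Ty S 0} (hA : T.Derivable .nil (.isType A))

/-- The map `x ↦ (x, x, r(x))`. -/
def reflMap : typeObj hA ⟶ I.pathObj hA :=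
  homMk (wf_nil_snoc hA) (I.wf_idCtx hA) (idDiag I.r A) (I.isMor_idDiag hA)

/-- The inverse is the source projection `(x, y, u) ↦ x`. One composite is the identity strictly;
the other sends `(x, y, u)` to `(x, x, r(x))`, and path induction identifies the two after coding
the path object by a closed type. -/
theorem homotopyEquivalences_reflMap (P : StrongSums T) :
    I.homotopyEquivalences (I.reflMap hA) := by
  refine ⟨homMk (I.wf_idCtx hA) (wf_nil_snoc hA) _ (I.isMor_idCtx_fst hA), ?_, ?_⟩
  · exact .of_eq P (homMk_congr I.idCtx_fst_comp_idDiag)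
  · obtain ⟨G, hG, ⟨e⟩⟩ := exists_iso_typeObj P (I.pathObj hA)
    obtain ⟨ε, hε, he⟩ := exists_eq_homMk_typeObj (hΔ := I.wf_idCtx hA) e.hom
    refine (I.homotopic_homMk_iff (hs := IsMor.comp (I.wf_idCtx hA) (I.isMor_idDiag hA)
      (I.isMor_idCtx_fst hA)) (ht := isMor_id (I.wf_idCtx hA)) e he).2 ?_
    have hε0 := hε.2
    rw [Subsingleton.elim ε.tail (Sub.empty S 3)] at hε0
    have hs := subst_mor (I.wf_idCtx hA) (IsMor.comp (I.wf_idCtx hA) (I.isMor_idDiag hA)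
      (I.isMor_idCtx_fst hA)) hε0
    simp only [Judgement.subst, Expr.subst_subst, Sub.comp_empty] at hs
    rw [Expr.subst_id]
    -- The motive identifies the code of `(x, x, r(x))` with the code of `(x, y, u)`; on the
    -- diagonal the codes coincide and reflexivity suffices.
    refine ⟨hs, hε0, I.hasElement_idCtx (I.Id_form hs hε0) ?_⟩
    rw [I.Id_subst, Expr.subst_subst (ε 0), Sub.comp_assoc, I.idCtx_fst_comp_idDiag, Sub.comp_id]
    have hd := subst_mor (wf_nil_snoc hA) (I.isMor_idDiag hA) hε0
    exact ⟨_, I.r_intro hd⟩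

/-- The product of `[x ∈ A]` with itself is `[x ∈ A, y ∈ A]`. -/
theorem isPullback_typeObj :
    IsPullback (proj (Ctx.nil.snoc A) (A.subst (Sub.wk S 0)) (I.wf_idCtx hA).1)
      (homMk (I.wf_idCtx hA).1 (wf_nil_snoc hA) (Sub.wk S 0).lift
        (IsMor.lift (wf_nil_snoc hA) (isMor_wk (wf_nil_snoc hA)) hA))
      (proj .nil A (wf_nil_snoc hA)) (proj .nil A (wf_nil_snoc hA)) :=
  (isPullback_proj (wf_nil_snoc hA) (isMor_wk (wf_nil_snoc hA))).flip

/-- For a closed type the fibration part is the display map that drops `u`. A general `B` is coded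
by such a type, and the coding `e` is absorbed into the map `r` and into the legs of the product,
leaving the fibration unchanged. -/
theorem nonempty_pathObject (P : StrongSums T) (B : T.ClassifyingCategory) :
    Nonempty (PathObject I.homotopyEquivalences T.fibrations B) := by
  obtain ⟨A, hA, ⟨e⟩⟩ := exists_iso_typeObj P B
  -- The product is a pullback over the empty context; both legs are composed with the inverse of
  -- `e` so that it becomes a product of `B` with itself.
  have sq : IsPullback _ _ (e.hom ≫ proj .nil A (wf_nil_snoc hA))
      (e.hom ≫ proj .nil A (wf_nil_snoc hA)) :=
    (I.isPullback_typeObj hA).of_iso (Iso.refl _) e.symm e.symm (Iso.refl _)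
      (Category.id_comp _).symm (Category.id_comp _).symm
      ((Category.comp_id _).trans (e.inv_hom_id_assoc _).symm)
      ((Category.comp_id _).trans (e.inv_hom_id_assoc _).symm)
  have key : ∀ {Q R : T.ClassifyingCategory} (a : typeObj hA ⟶ Q) (b : Q ⟶ R)
      (c : R ⟶ typeObj hA), a ≫ b ≫ c = 𝟙 _ → (e.hom ≫ a) ≫ b ≫ c ≫ e.inv = 𝟙 B := by
    intro Q R a b c h
    rw [← Category.assoc b, Category.assoc, ← Category.assoc a, h, Category.id_comp, e.hom_inv_id]
  exact ⟨{
    prod := BinaryFan.mk _ _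
    isLimit := isProductOfIsTerminalIsPullback _ _ _ _ isTerminalNil sq.isLimit
    obj := I.pathObj hA
    r := e.hom ≫ I.reflMap hA
    st := proj _ _ (I.wf_idCtx hA)
    weq_r := I.homotopyEquivalences_comp P (I.homotopyEquivalences_of_isIso P _ inferInstance)
      (I.homotopyEquivalences_reflMap hA P)
    fib_st := fibrations_proj _
    fac_fst := key _ _ _ (homMk_congr I.idCtx_fst_comp_idDiag)
    fac_snd := key _ _ _ (homMk_congr I.idCtx_snd_comp_idDiag) }⟩

end PathObjects

/-- The classifying category is a path category. -/
def pathCategory (P : StrongSums T) : PathCategory T.ClassifyingCategory where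
  fib := T.fibrations
  weq := I.homotopyEquivalences
  fib_of_isIso f _ := fibrations_of_isIso f
  fib_comp f g hf hg := fibrations_comp P f g hf hg
  hasPullback p f hp := hasPullback_of_fibrations P p f hp
  fib_pullback sq hp := fibrations_of_isPullback P sq hp
  hasTerminal := isTerminalNil.hasTerminal
  fib_terminal f hZ := fibrations_to_terminal P f hZ
  weq_of_isIso f hf := I.homotopyEquivalences_of_isIso P f hf
  two_out_of_six f g h hfg hgh := I.homotopyEquivalences_two_out_of_six P f g h hfg hgh
  pathObject B := I.nonempty_pathObject P B
  acyclic_section p hp hp' := I.exists_section_of_acyclic P p hp hp'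
  acyclic_pullback sq hp hp' :=
    ⟨fibrations_of_isPullback P sq hp, I.homotopyEquivalences_of_isPullback P sq hp hp'⟩

end PropositionalIdTypes

end DTT

theorem mainTheorem3 {S : DTT.Signature.{u}} (T : DTT.TypeTheory S) (_sums : DTT.StrongSums T)
    (I : DTT.PropositionalIdTypes T) :
    ∃ P : DTT.PathCategory T.ClassifyingCategory,
      P.fib = T.fibrations ∧ P.weq = I.homotopyEquivalences := by
  exact ⟨I.pathCategory _sums, rfl, rfl⟩
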